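/- Let $E$ be an infinite-dimensional separable real Hilbert space with orthonormal basis $\mathcal E=\{e_j\}_{j\ge 1}$. For bounded real sequences $a,b$ with $a_j<b_j$ for all $j$, the block $\Pi_{a,b}=\{x\in E:\ (e_j,x)\in[a_j,b_j)\ \forall j\}$ is called absolutely measurable if it is empty or $\sum_j\max\{0,\ln(b_j-a_j)\}<\infty$; put $\lambda_{\mathcal E}(\Pi_{a,b})=\prod_{j}(b_j-a_j)$ if $\Pi_{a,b}\ne\emptyset$, and $\lambda_{\mathcal E}(\emptyset)=0$. Extend $\lambda_{\mathcal E}$ (uniquely) to a finitely additive measure on the ring $r_{\mathcal E}$ generated by the absolutely measurable blocks, and then to the completion $\mathcal R_{\mathcal E}$ of this ring, i.e. the ring of sets $A$ such that for every $\varepsilon>0$ there are $B,C\in r_{\mathcal E}$ with $B\subseteq A\subseteq C$ and $\lambda_{\mathcal E}(C\setminus B)<\varepsilon$. Let $\mathcal H_{\mathcal E}$ be the complex Hilbert space obtained by completing the space of linear combinations of indicator functions of sets of $\mathcal R_{\mathcal E}$, modulo null vectors, with respect to $(\chi_A,\chi_B)=\lambda_{\mathcal E}(A\cap B)$. For $n\in\mathbb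 N$ let $E_n=\mathrm{span}(e_1,\dots,e_n)\cong\mathbb R^n$, $E^n=E_n^{\perp}$ and $\mathcal E^n=\{e_{n+1},e_{n+2},\dots\}$; let $\mathcal F_{E_n}$ be the unitary Fourier transform of $L_2(E_n)$, given on $L_1\cap L_2$ by $(\mathcal F_{E_n}f)(\xi)=(2\pi)^{-n/2}\int_{E_n}e^{-i(x,\xi)}f(x)\,dx$. Then, for every $n$, under the unitary identification $\mathcal H_{\mathcal E}=L_2(E_n)\otimes\mathcal H_{\mathcal E^n}$ that sends $\chi_A\otimes\chi_B$ to $\chi_{A\times B}$ for each box $A=\prod_{j\le n}[a_j,b_j)$ in $E_n$ and each absolutely measurable block $B$ of $E^n$, there is exactly one bounded operator $\mathcal F_n$ on $\mathcal H_{\mathcal E}$ with $\mathcal F_n(f\otimes g)=(\mathcal F_{E_n}f)\otimes g$ for all $f\in L_2(E_n)$, $g\in\mathcal H_{\mathcal E^n}$ (the partial Fourier transform in the first $n$ variables). The operators $\mathcal F_n$ are unitary, and they converge weakly to zero: $$\lim_{n\to\infty}(\mathcal F_n v,u)=0\qquad\text{for all }u,v\in\mathcal H_{\mathcal E}.$$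 -/

import Mathlib

open MeasureTheory Filter Topology Set
open scoped ENNReal NNReal TensorProduct

namespace QuantumWalk
/-- The smallest ring of sets containing the collection `C`. -/
def generatedRing {α : Type*} (C : Set (Set α)) : Set (Set α) :=
  {A | ∀ R : Set (Set α), IsSetRing R → C ⊆ R → A ∈ R}

theorem isSetRing_generatedRing {α : Type*} (C : Set (Set α)) : IsSetRing (generatedRing C) where
  empty_mem := fun _ hR _ => hR.empty_mem
  union_mem := fun _ _ hs ht R hR hC => hR.union_mem (hs R hR hC) (ht R hR hC)
  sdiff_mem := fun _ _ hs ht R hR hC => hR.sdiff_mem (hs R hR hC) (ht R hR hC)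

theorem subset_generatedRing {α : Type*} (C : Set (Set α)) : C ⊆ generatedRing C :=
  fun _ hA _ _ hC => hC hA


/-- A finitely additive measure with finite nonnegative values on a ring of subsets of `α`. -/
structure FinAddMeasure (α : Type*) where
  ring : Set (Set α)
  isSetRing : IsSetRing ring
  content : AddContent ℝ≥0 ring

namespace FinAddMeasure

variable {α β γ : Type*} (μ : FinAddMeasure α)

section Completion

/-- The sets that can be approximated in measure by sets of the ring, from inside and outside. -/
def completedRing : Set (Set α) :=
  {A | ∀ ε : ℝ≥0, 0 < ε → ∃ B ∈ μ.ring, ∃ C ∈ μ.ring, B ⊆ A ∧ A ⊆ C ∧ μ.content (C \ B) < ε}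

/-- The measure of a set of the completed ring: the infimum of the measures of the sets of the
ring that contain it. -/
noncomputable def completedValue (A : Set α) : ℝ≥0 :=
  ⨅ C : {C : Set α // C ∈ μ.ring ∧ A ⊆ C}, μ.content C

variable {μ}

theorem content_mono {A B : Set α} (hA : A ∈ μ.ring) (hB : B ∈ μ.ring) (h : A ⊆ B) :
    μ.content A ≤ μ.content B :=
  addContent_mono μ.isSetRing.isSetSemiring hA hB h

theorem content_union_le {A B : Set α} (hA : A ∈ μ.ring) (hB : B ∈ μ.ring) :
    μ.content (A ∪ B) ≤ μ.content A + μ.content B :=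
  addContent_union_le μ.isSetRing hA hB

theorem content_le_add_sdiff {B C : Set α} (hB : B ∈ μ.ring) (hC : C ∈ μ.ring) :
    μ.content C ≤ μ.content B + μ.content (C \ B) := by
  refine (content_mono hC (μ.isSetRing.union_mem hB (μ.isSetRing.sdiff_mem hC hB)) ?_).trans
    (content_union_le hB (μ.isSetRing.sdiff_mem hC hB))
  rw [union_sdiff_self]
  exact subset_union_right

theorem completedValue_le {A C : Set α} (hC : C ∈ μ.ring) (h : A ⊆ C) :
    μ.completedValue A ≤ μ.content C :=
  ciInf_le (OrderBot.bddBelow _) (⟨C, hC, h⟩ : {C : Set α // C ∈ μ.ring ∧ A ⊆ C})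

theorem le_completedValue {A : Set α} (hA : A ∈ μ.completedRing) {a : ℝ≥0}
    (h : ∀ C ∈ μ.ring, A ⊆ C → a ≤ μ.content C) : a ≤ μ.completedValue A := by
  obtain ⟨B, hB, C, hC, h1, h2, -⟩ := hA 1 one_pos
  have : Nonempty {C : Set α // C ∈ μ.ring ∧ A ⊆ C} := ⟨⟨C, hC, h2⟩⟩
  exact le_ciInf fun C => h C.1 C.2.1 C.2.2

theorem isSetRing_completedRing : IsSetRing μ.completedRing where
  empty_mem := fun ε hε => ⟨∅, μ.isSetRing.empty_mem, ∅, μ.isSetRing.empty_mem, Subset.refl _,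
    Subset.refl _, by simpa using hε⟩
  union_mem := fun A A' hA hA' ε hε => by
    obtain ⟨B, hB, C, hC, h1, h2, h3⟩ := hA (ε / 2) (half_pos hε)
    obtain ⟨B', hB', C', hC', h1', h2', h3'⟩ := hA' (ε / 2) (half_pos hε)
    have hU := μ.isSetRing.union_mem
    have hD := μ.isSetRing.sdiff_mem
    refine ⟨B ∪ B', hU hB hB', C ∪ C', hU hC hC', union_subset_union h1 h1',
      union_subset_union h2 h2', ?_⟩
    calc _ ≤ μ.content ((C \ B) ∪ (C' \ B')) := by
          refine content_mono (hD (hU hC hC') (hU hB hB')) (hU (hD hC hB) (hD hC' hB')) ?_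
          rintro x ⟨hx, hx'⟩
          simp only [mem_union, not_or] at hx'
          exact hx.imp (fun h => ⟨h, hx'.1⟩) fun h => ⟨h, hx'.2⟩
      _ ≤ _ := content_union_le (hD hC hB) (hD hC' hB')
      _ < ε / 2 + ε / 2 := add_lt_add h3 h3'
      _ = ε := add_halves ε
  sdiff_mem := fun A A' hA hA' ε hε => by
    obtain ⟨B, hB, C, hC, h1, h2, h3⟩ := hA (ε / 2) (half_pos hε)
    obtain ⟨B', hB', C', hC', h1', h2', h3'⟩ := hA' (ε / 2) (half_pos hε)
    have hU := μ.isSetRing.union_mem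
    have hD := μ.isSetRing.sdiff_mem
    refine ⟨B \ C', hD hB hC', C \ B', hD hC hB', sdiff_subset_sdiff h1 h2',
      sdiff_subset_sdiff h2 h1', ?_⟩
    calc _ ≤ μ.content ((C \ B) ∪ (C' \ B')) := by
          refine content_mono (hD (hD hC hB') (hD hB hC')) (hU (hD hC hB) (hD hC' hB')) ?_
          rintro x ⟨⟨hx1, hx2⟩, hx3⟩
          by_cases hxB : x ∈ B
          · exact Or.inr ⟨by_contra fun h => hx3 ⟨hxB, h⟩, hx2⟩
          · exact Or.inl ⟨hx1, hxB⟩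
      _ ≤ _ := content_union_le (hD hC hB) (hD hC' hB')
      _ < ε / 2 + ε / 2 := add_lt_add h3 h3'
      _ = ε := add_halves ε

theorem completedValue_union {A A' : Set α} (hA : A ∈ μ.completedRing)
    (hA' : A' ∈ μ.completedRing) (hd : Disjoint A A') :
    μ.completedValue (A ∪ A') = μ.completedValue A + μ.completedValue A' := by
  have hU := μ.isSetRing.union_mem
  have key : ∀ ε : ℝ≥0, 0 < ε →
      μ.completedValue (A ∪ A') ≤ μ.completedValue A + μ.completedValue A' + ε ∧
      μ.completedValue A + μ.completedValue A' ≤ μ.completedValue (A ∪ A') + ε := by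
    intro ε hε
    obtain ⟨B, hB, C, hC, h1, h2, h3⟩ := hA (ε / 2) (half_pos hε)
    obtain ⟨B', hB', C', hC', h1', h2', h3'⟩ := hA' (ε / 2) (half_pos hε)
    have e1 := content_le_add_sdiff hB hC
    have e1' := content_le_add_sdiff hB' hC'
    have e2 : μ.content B ≤ μ.completedValue A :=
      le_completedValue hA fun C hC h => content_mono hB hC (h1.trans h)
    have e2' : μ.content B' ≤ μ.completedValue A' :=
      le_completedValue hA' fun C hC h => content_mono hB' hC (h1'.trans h)
    have e3 : μ.completedValue A ≤ μ.content C := completedValue_le hC h2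
    have e3' : μ.completedValue A' ≤ μ.content C' := completedValue_le hC' h2'
    have e4 : μ.completedValue (A ∪ A') ≤ μ.content C + μ.content C' :=
      (completedValue_le (hU hC hC') (union_subset_union h2 h2')).trans (content_union_le hC hC')
    have e5 : μ.content B + μ.content B' ≤ μ.completedValue (A ∪ A') := by
      rw [← addContent_union μ.isSetRing hB hB' (hd.mono h1 h1')]
      exact le_completedValue (isSetRing_completedRing.union_mem hA hA') fun C hC h =>
        content_mono (hU hB hB') hC ((union_subset_union h1 h1').trans h)
    have hh : (ε : ℝ) / 2 + ε / 2 = ε := add_halves _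
    rw [← NNReal.coe_le_coe] at *
    rw [← NNReal.coe_lt_coe] at h3 h3'
    push_cast at *
    constructor <;> linarith
  exact le_antisymm (le_of_forall_pos_le_add fun ε hε => (key ε hε).1)
    (le_of_forall_pos_le_add fun ε hε => (key ε hε).2)

variable (μ) in
/-- The completion of a finitely additive measure. -/
noncomputable def completion : FinAddMeasure α where
  ring := μ.completedRing
  isSetRing := isSetRing_completedRing
  content := isSetRing_completedRing.addContent_of_union μ.completedValue
    (le_antisymm ((completedValue_le μ.isSetRing.empty_mem (Subset.refl _)).trans (by simp))
      zero_le) completedValue_union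

theorem ring_subset_completion : μ.ring ⊆ μ.completion.ring := fun A hA ε hε =>
  ⟨A, hA, A, hA, Subset.refl _, Subset.refl _, by simpa using hε⟩

end Completion

section Simple

/-- A map with finitely many values whose level sets, except for that of `z`, are in the ring. -/
def IsSimple (z : β) (k : α → β) : Prop :=
  (range k).Finite ∧ ∀ b, b ≠ z → k ⁻¹' {b} ∈ μ.ring

/-- The integral of a simple function. -/
noncomputable def integral (f : α → ℂ) : ℂ := ∑ᶠ c : ℂ, c * (μ.content (f ⁻¹' {c}) : ℝ)

variable {μ}

theorem IsSimple.preimage_mem {z : β} {k : α → β} (hk : μ.IsSimple z k) {T : Set β} (hT : z ∉ T) :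
    k ⁻¹' T ∈ μ.ring := by
  classical
  have : k ⁻¹' T = ⋃ b ∈ hk.1.toFinset.filter (· ∈ T), k ⁻¹' {b} := by
    ext x; simp
  rw [this]
  refine μ.isSetRing.biUnion_mem _ fun b hb => hk.2 b ?_
  rintro rfl
  exact hT (Finset.mem_filter.1 hb).2

theorem IsSimple.prodMk {z : β} {k : α → β} {z' : γ} {k' : α → γ} (hk : μ.IsSimple z k)
    (hk' : μ.IsSimple z' k') : μ.IsSimple (z, z') fun x => (k x, k' x) := by
  refine ⟨(hk.1.prod hk'.1).subset ?_, ?_⟩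
  · rintro _ ⟨x, rfl⟩; exact ⟨⟨x, rfl⟩, ⟨x, rfl⟩⟩
  rintro ⟨b, b'⟩ hb
  by_cases h : b = z
  · have h' : b' ≠ z' := fun h' => hb (by rw [h, h'])
    have : (fun x => (k x, k' x)) ⁻¹' {(b, b')} = k' ⁻¹' {b'} \ k ⁻¹' {z}ᶜ := by
      ext x; simp [h, and_comm]
    rw [this]
    exact μ.isSetRing.sdiff_mem (hk'.2 _ h') (hk.preimage_mem (by simp))
  · by_cases h' : b' = z'
    · have : (fun x => (k x, k' x)) ⁻¹' {(b, b')} = k ⁻¹' {b} \ k' ⁻¹' {z'}ᶜ := by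
        ext x; simp [h']
      rw [this]
      exact μ.isSetRing.sdiff_mem (hk.2 _ h) (hk'.preimage_mem (by simp))
    · have : (fun x => (k x, k' x)) ⁻¹' {(b, b')} = k ⁻¹' {b} ∩ k' ⁻¹' {b'} := by
        ext x; simp
      rw [this]
      exact μ.isSetRing.inter_mem (hk.2 _ h) (hk'.2 _ h')

theorem IsSimple.comp {z : β} {k : α → β} (hk : μ.IsSimple z k) (h : β → γ) :
    μ.IsSimple (h z) fun x => h (k x) := by
  refine ⟨?_, fun c hc => ?_⟩
  · rw [range_comp' h k]; exact hk.1.image h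
  · exact hk.preimage_mem (T := h ⁻¹' {c}) (by simpa using hc.symm)

open scoped Classical in
theorem IsSimple.integral_comp {z : β} {k : α → β} (hk : μ.IsSimple z k) (h : β → ℂ)
    (hz : h z = 0) : μ.integral (fun x => h (k x)) =
      ∑ b ∈ hk.1.toFinset.erase z, h b * (μ.content (k ⁻¹' {b}) : ℝ) := by
  set T := hk.1.toFinset.erase z with hT
  have hlev : ∀ c : ℂ, c ≠ 0 → μ.content ((fun x => h (k x)) ⁻¹' {c}) =
      ∑ b ∈ T with h b = c, μ.content (k ⁻¹' {b}) := by
    intro c hc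
    have : (fun x => h (k x)) ⁻¹' {c} = ⋃ b ∈ T.filter (fun b => h b = c), k ⁻¹' {b} := by
      ext x
      simp only [hT, mem_preimage, mem_singleton_iff, Finset.mem_filter, Finset.mem_erase,
        Finite.mem_toFinset, mem_range, mem_iUnion, exists_prop]
      constructor
      · exact fun hx => ⟨k x, ⟨⟨fun h' => hc (by rw [← hx, h', hz]), x, rfl⟩, hx⟩, rfl⟩
      · rintro ⟨b, ⟨-, hb⟩, rfl⟩; exact hb
    rw [this, addContent_biUnion_eq μ.isSetRing]
    · intro b hb
      exact hk.2 b (Finset.ne_of_mem_erase (Finset.mem_filter.1 hb).1)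
    · intro b _ b' _ hbb'
      exact Set.disjoint_left.2 fun x hx hx' => hbb' (hx.symm.trans hx')
  rw [integral, finsum_eq_sum_of_support_subset (s := T.image h)]
  · rw [← Finset.sum_fiberwise_of_maps_to (g := h) (t := T.image h)
      fun b hb => Finset.mem_image_of_mem h hb]
    refine Finset.sum_congr rfl fun c _ => ?_
    rcases eq_or_ne c 0 with rfl | hc
    · rw [zero_mul, Finset.sum_eq_zero]
      intro b hb
      rw [(Finset.mem_filter.1 hb).2, zero_mul]
    · rw [hlev c hc]
      push_cast
      rw [Finset.mul_sum]
      exact Finset.sum_congr rfl fun b hb => by rw [(Finset.mem_filter.1 hb).2]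
  · intro c hc
    have hc0 : c ≠ 0 := by rintro rfl; simp at hc
    by_contra hcT
    refine hc ?_
    simp only
    rw [hlev c hc0, Finset.sum_eq_zero]
    · simp
    · intro b hb
      obtain ⟨h1, h2⟩ := Finset.mem_filter.1 hb
      exact absurd (Finset.mem_coe.2 (h2 ▸ Finset.mem_image_of_mem h h1)) hcT

variable (μ) in
/-- The space of linear combinations of indicator functions of sets of the ring. -/
def simpleFunctions : Submodule ℂ (α → ℂ) :=
  Submodule.span ℂ {f | ∃ B ∈ μ.ring, f = B.indicator fun _ => 1}

theorem isSimple_of_mem {f : α → ℂ} (hf : f ∈ μ.simpleFunctions) : μ.IsSimple 0 f := by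
  induction hf using Submodule.span_induction with
  | mem f hf =>
    obtain ⟨B, hB, rfl⟩ := hf
    refine ⟨(Set.toFinite {0, 1}).subset ?_, fun c hc => ?_⟩
    · rintro _ ⟨x, rfl⟩
      by_cases hx : x ∈ B <;> simp [hx]
    · rcases eq_or_ne c 1 with rfl | h1
      · convert hB
        ext x
        by_cases hx : x ∈ B <;> simp [hx]
      · convert μ.isSetRing.empty_mem
        ext x
        by_cases hx : x ∈ B <;> simp [hx, hc.symm, h1.symm]
  | zero =>
    refine ⟨(Set.toFinite {0}).subset ?_, fun c hc => ?_⟩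
    · rintro _ ⟨x, rfl⟩; simp
    · convert μ.isSetRing.empty_mem
      ext x; simp [hc.symm]
  | add f g _ _ hf hg =>
    have h := (hf.prodMk hg).comp fun p => p.1 + p.2
    simp only [add_zero] at h
    exact h
  | smul c f _ hf =>
    have h := hf.comp fun a => c • a
    simp only [smul_zero] at h
    exact h

variable (μ) in
/-- The space of simple functions, with the sesquilinear form
`(f, g) = ∫ conj f · g dμ`. -/
def SimpleFn : Type _ := μ.simpleFunctions

noncomputable instance : AddCommGroup μ.SimpleFn := inferInstanceAs (AddCommGroup μ.simpleFunctions)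
noncomputable instance : Module ℂ μ.SimpleFn := inferInstanceAs (Module ℂ μ.simpleFunctions)

/-- The function underlying an element of `SimpleFn`. -/
def SimpleFn.fn (f : μ.SimpleFn) : α → ℂ := Subtype.val (p := (· ∈ μ.simpleFunctions)) f

theorem SimpleFn.isSimple (f : μ.SimpleFn) : μ.IsSimple 0 f.fn :=
  isSimple_of_mem (Subtype.property (p := (· ∈ μ.simpleFunctions)) f)

open ComplexConjugate in
noncomputable instance : PreInnerProductSpace.Core ℂ μ.SimpleFn where
  inner f g := μ.integral fun x => conj (f.fn x) * g.fn x
  conj_inner_symm f g := by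
    have hk := f.isSimple.prodMk g.isSimple
    have e1 := hk.integral_comp (fun p => conj p.1 * p.2) (by simp)
    have e2 := hk.integral_comp (fun p => conj p.2 * p.1) (by simp)
    simp only at e1 e2
    rw [e1, e2, map_sum]
    refine Finset.sum_congr rfl fun p _ => ?_
    simp [mul_comm]
  re_inner_nonneg f := by
    have e1 := f.isSimple.integral_comp (fun c => conj c * c) (by simp)
    rw [e1, map_sum]
    refine Finset.sum_nonneg fun c _ => ?_
    rw [← Complex.normSq_eq_conj_mul_self, ← Complex.ofReal_mul]
    simp only [RCLike.re_to_complex, Complex.ofReal_re]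
    exact mul_nonneg (Complex.normSq_nonneg _) (NNReal.coe_nonneg _)
  add_left f f' g := by
    have hk := (f.isSimple.prodMk f'.isSimple).prodMk g.isSimple
    have e1 := hk.integral_comp (fun p => conj (p.1.1 + p.1.2) * p.2) (by simp)
    have e2 := hk.integral_comp (fun p => conj p.1.1 * p.2) (by simp)
    have e3 := hk.integral_comp (fun p => conj p.1.2 * p.2) (by simp)
    simp only at e1 e2 e3
    change μ.integral (fun x => conj (f.fn x + f'.fn x) * g.fn x) = _
    rw [e1, e2, e3, ← Finset.sum_add_distrib]
    refine Finset.sum_congr rfl fun p _ => ?_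
    rw [map_add, add_mul, add_mul]
  smul_left f g c := by
    have hk := f.isSimple.prodMk g.isSimple
    have e1 := hk.integral_comp (fun p => conj (c * p.1) * p.2) (by simp)
    have e2 := hk.integral_comp (fun p => conj p.1 * p.2) (by simp)
    simp only at e1 e2
    change μ.integral (fun x => conj (c * f.fn x) * g.fn x) = _
    rw [e1, e2, Finset.mul_sum]
    refine Finset.sum_congr rfl fun p _ => ?_
    rw [map_mul, mul_assoc, mul_assoc, mul_assoc]

noncomputable instance : SeminormedAddCommGroup μ.SimpleFn :=
  InnerProductSpace.Core.toSeminormedAddCommGroup (𝕜 := ℂ)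

noncomputable instance : InnerProductSpace ℂ μ.SimpleFn := InnerProductSpace.ofCore _

variable (μ) in
/-- The Hilbert space of square integrable functions: the completion of the quotient of the space
of simple functions by the subspace of functions of seminorm zero. -/
abbrev L2 : Type _ := UniformSpace.Completion (SeparationQuotient μ.SimpleFn)

theorem indicator_mem_simpleFunctions {B : Set α} (hB : B ∈ μ.ring) :
    (B.indicator fun _ => 1) ∈ μ.simpleFunctions :=
  Submodule.subset_span ⟨B, hB, rfl⟩

/-- The indicator function of a set of the ring, as a simple function. -/
noncomputable def SimpleFn.indicator (B : Set α) (hB : B ∈ μ.ring) : μ.SimpleFn :=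
  Subtype.mk (p := (· ∈ μ.simpleFunctions)) (B.indicator fun _ => 1)
    (indicator_mem_simpleFunctions hB)

variable (μ) in
/-- The element of `L2` defined by the indicator function of a set of the ring. -/
noncomputable def indicator (B : Set α) (hB : B ∈ μ.ring) : μ.L2 :=
  ((SeparationQuotient.mk (SimpleFn.indicator B hB) : SeparationQuotient μ.SimpleFn) : μ.L2)

theorem inner_simpleFn (f g : μ.SimpleFn) :
    inner ℂ f g = μ.integral fun x => (starRingEnd ℂ) (f.fn x) * g.fn x := rfl


end Simple


section Uniqueness

theorem integral_indicator (μ : FinAddMeasure α) (B : Set α) :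
    μ.integral (B.indicator fun _ => 1) = (μ.content B : ℝ) := by
  have h : ∀ c : ℂ, c ≠ 1 → c * (μ.content ((B.indicator fun _ => (1 : ℂ)) ⁻¹' {c}) : ℝ) = 0 := by
    intro c hc
    rcases eq_or_ne c 0 with rfl | h0
    · simp
    have : (B.indicator fun _ => (1 : ℂ)) ⁻¹' {c} = ∅ := by
      ext x
      by_cases hx : x ∈ B <;> simp [hx, hc.symm, h0.symm]
    simp [this]
  have h1 : (B.indicator fun _ => (1 : ℂ)) ⁻¹' {1} = B := by
    ext x
    by_cases hx : x ∈ B <;> simp [hx]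
  rw [integral, finsum_eq_single _ 1 h, h1, one_mul]

theorem integral_add (μ : FinAddMeasure α) {f g : α → ℂ} (hf : μ.IsSimple 0 f)
    (hg : μ.IsSimple 0 g) : μ.integral (f + g) = μ.integral f + μ.integral g := by
  have hk := hf.prodMk hg
  have e1 := hk.integral_comp (fun p => p.1 + p.2) (by simp)
  have e2 := hk.integral_comp (fun p => p.1) rfl
  have e3 := hk.integral_comp (fun p => p.2) rfl
  change μ.integral (fun x => f x + g x) = μ.integral (fun x => f x) + μ.integral (fun x => g x)
  rw [e1, e2, e3, ← Finset.sum_add_distrib]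
  exact Finset.sum_congr rfl fun p _ => by rw [add_mul]

theorem integral_smul (μ : FinAddMeasure α) {f : α → ℂ} (c : ℂ) (hf : μ.IsSimple 0 f) :
    μ.integral (c • f) = c * μ.integral f := by
  have e1 := hf.integral_comp (fun a => c * a) (by simp)
  have e2 := hf.integral_comp (fun a => a) rfl
  change μ.integral (fun x => c * f x) = c * μ.integral (fun x => f x)
  rw [e1, e2, Finset.mul_sum]
  exact Finset.sum_congr rfl fun p _ => by rw [mul_assoc]

/-- The indicator functions of the sets of the ring generated by an intersection-stable collection
are linear combinations of the indicator functions of its members. -/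
theorem indicator_mem_span {C : Set (Set α)} (hC : ∀ A ∈ C, ∀ B ∈ C, A ∩ B = ∅ ∨ A ∩ B ∈ C) {A : Set α}
    (hA : A ∈ generatedRing C) : (A.indicator fun _ => (1 : ℂ)) ∈
      Submodule.span ℂ {f : α → ℂ | ∃ B ∈ C, f = B.indicator fun _ => 1} := by
  set V := Submodule.span ℂ {f : α → ℂ | ∃ B ∈ C, f = B.indicator fun _ => 1} with hV
  have hmul : ∀ f ∈ V, ∀ g ∈ V, f * g ∈ V := by
    intro f hf g hg
    induction hf using Submodule.span_induction with
    | mem f hf =>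
      obtain ⟨A, hA, rfl⟩ := hf
      induction hg using Submodule.span_induction with
      | mem g hg =>
        obtain ⟨B, hB, rfl⟩ := hg
        have hAB : (A.indicator fun _ => (1 : ℂ)) * (B.indicator fun _ => 1) =
            (A ∩ B).indicator fun _ => 1 := by
          ext x
          by_cases h1 : x ∈ A <;> by_cases h2 : x ∈ B <;> simp [h1, h2]
        rw [hAB]
        rcases hC A hA B hB with h0 | h0
        · rw [h0, Set.indicator_empty]
          exact V.zero_mem
        · exact Submodule.subset_span ⟨A ∩ B, h0, rfl⟩
      | zero => rw [mul_zero]; exact V.zero_mem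
      | add g g' _ _ h h' => rw [mul_add]; exact V.add_mem h h'
      | smul c g _ h => rw [mul_smul_comm]; exact V.smul_mem c h
    | zero => rw [zero_mul]; exact V.zero_mem
    | add f f' _ _ h h' => rw [add_mul]; exact V.add_mem h h'
    | smul c f _ h => rw [smul_mul_assoc]; exact V.smul_mem c h
  refine hA {A | (A.indicator fun _ => (1 : ℂ)) ∈ V} ⟨?_, ?_, ?_⟩ fun B hB =>
    Submodule.subset_span ⟨B, hB, rfl⟩
  · change (Set.indicator (∅ : Set α) fun _ => (1 : ℂ)) ∈ V
    rw [Set.indicator_empty]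
    exact V.zero_mem
  · intro A B hA hB
    have : ((A ∪ B).indicator fun _ => (1 : ℂ)) = (A.indicator fun _ => (1 : ℂ)) +
        (B.indicator fun _ => (1 : ℂ)) -
        (A.indicator fun _ => (1 : ℂ)) * (B.indicator fun _ => (1 : ℂ)) := by
      ext x
      by_cases h1 : x ∈ A <;> by_cases h2 : x ∈ B <;> simp [h1, h2]
    change ((A ∪ B).indicator fun _ => (1 : ℂ)) ∈ V
    rw [this]
    exact V.sub_mem (V.add_mem hA hB) (hmul _ hA _ hB)
  · intro A B hA hB
    have : ((A \ B).indicator fun _ => (1 : ℂ)) = (A.indicator fun _ => (1 : ℂ)) -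
        (A.indicator fun _ => (1 : ℂ)) * (B.indicator fun _ => (1 : ℂ)) := by
      ext x
      by_cases h1 : x ∈ A <;> by_cases h2 : x ∈ B <;> simp [h1, h2]
    change ((A \ B).indicator fun _ => (1 : ℂ)) ∈ V
    rw [this]
    exact V.sub_mem hA (hmul _ hA _ hB)

theorem content_eq_of_generatedRing {C : Set (Set α)} (hC : ∀ A ∈ C, ∀ B ∈ C, A ∩ B = ∅ ∨ A ∩ B ∈ C)
    (m m' : AddContent ℝ≥0 (generatedRing C)) (h : ∀ B ∈ C, m B = m' B) :
    ∀ A ∈ generatedRing C, m A = m' A := by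
  intro A hA
  let μ : FinAddMeasure α := ⟨_, isSetRing_generatedRing C, m⟩
  let μ' : FinAddMeasure α := ⟨_, isSetRing_generatedRing C, m'⟩
  have key : ∀ f ∈ Submodule.span ℂ {f : α → ℂ | ∃ B ∈ C, f = B.indicator fun _ => 1},
      μ.IsSimple 0 f ∧ μ.integral f = μ'.integral f := by
    intro f hf
    have hsub : Submodule.span ℂ {f : α → ℂ | ∃ B ∈ C, f = B.indicator fun _ => 1} ≤
        μ.simpleFunctions := Submodule.span_mono fun _ ⟨B, hB, hf⟩ =>
      ⟨B, subset_generatedRing C hB, hf⟩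
    induction hf using Submodule.span_induction with
    | mem f hf =>
      obtain ⟨B, hB, rfl⟩ := hf
      refine ⟨isSimple_of_mem (hsub (Submodule.subset_span ⟨B, hB, rfl⟩)), ?_⟩
      rw [integral_indicator μ B, integral_indicator μ' B]
      change ((m B : ℝ) : ℂ) = (m' B : ℝ)
      rw [h B hB]
    | zero =>
      have h0 : μ.IsSimple 0 (0 : α → ℂ) := isSimple_of_mem μ.simpleFunctions.zero_mem
      refine ⟨h0, ?_⟩
      have e1 := integral_smul μ 0 h0
      have e2 := integral_smul μ' 0 h0
      rw [zero_smul, zero_mul] at e1 e2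
      rw [e1, e2]
    | add f g hf hg h1 h2 =>
      refine ⟨isSimple_of_mem (μ.simpleFunctions.add_mem (hsub hf) (hsub hg)), ?_⟩
      rw [integral_add μ h1.1 h2.1, integral_add μ' h1.1 h2.1, h1.2, h2.2]
    | smul c f hf h1 =>
      refine ⟨isSimple_of_mem (μ.simpleFunctions.smul_mem c (hsub hf)), ?_⟩
      rw [integral_smul μ c h1.1, integral_smul μ' c h1.1, h1.2]
  have := (key _ (indicator_mem_span hC hA)).2
  rw [integral_indicator μ A, integral_indicator μ' A] at this
  exact NNReal.coe_injective (Complex.ofReal_injective this)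

end Uniqueness

end FinAddMeasure

section Blocks

variable {E : Type*} [NormedAddCommGroup E] [InnerProductSpace ℝ E]

/-- The block `{x ∈ E : (e_j, x) ∈ [a_j, b_j) for all j}`. -/
def block (e : HilbertBasis ℕ ℝ E) (a b : ℕ → ℝ) : Set E :=
  {x | ∀ j, inner ℝ (e j) x ∈ Ico (a j) (b j)}

/-- The endpoint sequences of an absolutely measurable block: they are bounded, `a_j < b_j` for
all `j`, and the block is empty (as a subset of `E`) or `∑ max {0, ln (b_j - a_j)} < ∞`. -/
structure IsAbsMeasurableBlock (e : HilbertBasis ℕ ℝ E) (a b : ℕ → ℝ) : Prop where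
  bounded_left : BddAbove (range fun j => |a j|)
  bounded_right : BddAbove (range fun j => |b j|)
  lt : ∀ j, a j < b j
  summable : block e a b = ∅ ∨ Summable fun j => max 0 (Real.log (b j - a j))

/-- The ring `r_𝓔` generated by the absolutely measurable blocks. -/
def blockRing (e : HilbertBasis ℕ ℝ E) : Set (Set E) :=
  generatedRing {A | ∃ a b, IsAbsMeasurableBlock e a b ∧ A = block e a b}

open scoped Classical in
/-- The number `λ_𝓔(Π_{a,b})`: the product of the side lengths of a nonempty block, and `0` for an
empty one. -/
noncomputable def blockVolume (e : HilbertBasis ℕ ℝ E) (a b : ℕ → ℝ) : ℝ :=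
  if (block e a b).Nonempty then ∏' j, (b j - a j) else 0

end Blocks

namespace BlockMeasure

/-- positive parts of the logarithms summable: the infinite product converges in `[0, ∞)`. -/
theorem multipliable_of_summable_log {c : ℕ → ℝ} (h0 : ∀ j, 0 ≤ c j)
    (h : Summable fun j => max 0 (Real.log (c j))) : Multipliable c := by
  have hp : Multipliable fun j => max 1 (c j) := by
    have h1 : (fun j => max 1 (c j)) = fun j => Real.exp (max 0 (Real.log (c j))) := by
      funext j
      rcases le_total (c j) 1 with h | h
      · rw [max_eq_left h, max_eq_left (Real.log_nonpos (h0 j) h), Real.exp_zero]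
      · rw [max_eq_right h, max_eq_right (Real.log_nonneg h), Real.exp_log (by linarith)]
    rw [h1]
    exact h.hasSum.rexp.multipliable
  have hq : Multipliable fun j => min 1 (c j) := by
    have ha : Antitone fun s : Finset ℕ => ∏ j ∈ s, min 1 (c j) := fun s t hst => by
      change ∏ j ∈ t, min 1 (c j) ≤ ∏ j ∈ s, min 1 (c j)
      rw [← Finset.prod_sdiff hst]
      exact mul_le_of_le_one_left
        (Finset.prod_nonneg fun i _ => le_min zero_le_one (h0 i))
        (Finset.prod_le_one (fun i _ => le_min zero_le_one (h0 i)) fun i _ => min_le_left _ _)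
    have hb : BddBelow (range fun s : Finset ℕ => ∏ j ∈ s, min 1 (c j)) := by
      refine ⟨0, ?_⟩
      rintro _ ⟨s, rfl⟩
      exact Finset.prod_nonneg fun i _ => le_min zero_le_one (h0 i)
    refine ⟨⨅ s : Finset ℕ, ∏ j ∈ s, min 1 (c j), ?_⟩
    unfold HasProd
    simp only [SummationFilter.unconditional_filter]
    exact tendsto_atTop_ciInf ha hb
  have : c = fun j => max 1 (c j) * min 1 (c j) := by
    funext j; rw [max_mul_min, one_mul]
  rw [this]
  exact hp.mul hq

structure Box where
  l : ℕ → ℝ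
  u : ℕ → ℝ
  le : ∀ j, l j ≤ u j
  summ : Summable fun j => max 0 (Real.log (u j - l j))

namespace Box

def carrier (p : Box) : Set (ℕ → ℝ) := {x | ∀ j, x j ∈ Ico (p.l j) (p.u j)}

noncomputable def vol (p : Box) : ℝ := ∏' j, (p.u j - p.l j)

theorem mult (p : Box) : Multipliable fun j => p.u j - p.l j :=
  multipliable_of_summable_log (fun j => sub_nonneg.2 (p.le j)) p.summ

theorem tendsto_vol (p : Box) :
    Tendsto (fun n => ∏ j ∈ Finset.range n, (p.u j - p.l j)) atTop (𝓝 p.vol) :=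
  p.mult.hasProd.tendsto_prod_nat

theorem vol_nonneg (p : Box) : 0 ≤ p.vol :=
  ge_of_tendsto' p.tendsto_vol fun _ => Finset.prod_nonneg fun j _ => sub_nonneg.2 (p.le j)

theorem measurableSet (p : Box) : MeasurableSet p.carrier := by
  have : p.carrier = ⋂ j, (fun x : ℕ → ℝ => x j) ⁻¹' Ico (p.l j) (p.u j) := by
    ext x; simp [carrier]
  rw [this]
  exact MeasurableSet.iInter fun j => (measurable_pi_apply j) measurableSet_Ico

theorem exists_inter (p q : Box) (h : (p.carrier ∩ q.carrier).Nonempty) :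
    ∃ r : Box, r.carrier = p.carrier ∩ q.carrier ∧ (∀ j, r.l j = max (p.l j) (q.l j)) ∧
      ∀ j, r.u j = min (p.u j) (q.u j) := by
  obtain ⟨x, hx, hy⟩ := h
  have hlt : ∀ j, max (p.l j) (q.l j) < min (p.u j) (q.u j) := fun j =>
    (max_le (hx j).1 (hy j).1).trans_lt (lt_min (hx j).2 (hy j).2)
  refine ⟨⟨fun j => max (p.l j) (q.l j), fun j => min (p.u j) (q.u j), fun j => (hlt j).le, ?_⟩,
    ?_, fun j => rfl, fun j => rfl⟩
  · refine Summable.of_nonneg_of_le (fun j => le_max_left _ _) (fun j => ?_) p.summ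
    refine max_le_max le_rfl (Real.log_le_log (sub_pos.2 (hlt j)) ?_)
    exact sub_le_sub (min_le_left _ _) (le_max_left _ _)
  · ext x
    simp only [carrier, mem_ofPred_eq, mem_inter_iff, mem_Ico, max_le_iff, lt_min_iff]
    exact ⟨fun h => ⟨fun j => ⟨(h j).1.1, (h j).2.1⟩, fun j => ⟨(h j).1.2, (h j).2.2⟩⟩,
      fun h j => ⟨⟨(h.1 j).1, (h.2 j).1⟩, ⟨(h.1 j).2, (h.2 j).2⟩⟩⟩

/-- Cutting a box along a coordinate hyperplane. -/
theorem exists_split (p : Box) (i : ℕ) (r : ℝ) : ∃ q q' : Box,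
    p.carrier ∩ {x | x i < r} ⊆ q.carrier ∧ p.carrier \ {x | x i < r} ⊆ q'.carrier ∧ q.vol + q'.vol = p.vol := by
  classical
  set t := max (p.l i) (min r (p.u i)) with ht
  have hlt : p.l i ≤ t := le_max_left _ _
  have htu : t ≤ p.u i := max_le (p.le i) (min_le_right _ _)
  have hs : ∀ (c c' : ℕ → ℝ), (∀ j ≠ i, c j = c' j) →
      (Summable fun j => max 0 (Real.log (c' j))) → Summable fun j => max 0 (Real.log (c j)) := by
    intro c c' h h'
    refine (summable_congr_cofinite ?_).1 h'
    have : ({i}ᶜ : Set ℕ) ∈ cofinite := by simp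
    filter_upwards [this] with j hj
    rw [h j hj]
  have hq1 : ∀ j, p.l j ≤ Function.update p.u i t j := fun j => by
    rcases eq_or_ne j i with rfl | h
    · simpa using hlt
    · simpa [h] using p.le j
  have hq2 : ∀ j, Function.update p.l i t j ≤ p.u j := fun j => by
    rcases eq_or_ne j i with rfl | h
    · simpa using htu
    · simpa [h] using p.le j
  refine ⟨⟨p.l, Function.update p.u i t, hq1, hs _ _ ?_ p.summ⟩,
    ⟨Function.update p.l i t, p.u, hq2, hs _ _ ?_ p.summ⟩, ?_, ?_, ?_⟩
  · intro j hj; simp [hj]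
  · intro j hj; simp [hj]
  · rintro x ⟨hx, hxr⟩ j
    rcases eq_or_ne j i with rfl | h
    · refine ⟨(hx j).1, ?_⟩
      simp only [Function.update_self]
      exact lt_max_of_lt_right (lt_min hxr (hx j).2)
    · simpa [h] using hx j
  · rintro x ⟨hx, hxr⟩ j
    rcases eq_or_ne j i with rfl | h
    · refine ⟨?_, (hx j).2⟩
      simp only [Function.update_self]
      exact max_le (hx j).1 ((min_le_left _ _).trans (not_lt.1 hxr))
    · simpa [h] using hx j
  · refine tendsto_nhds_unique ((tendsto_vol _).add (tendsto_vol _)) ?_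
    refine p.tendsto_vol.congr' ?_
    filter_upwards [eventually_gt_atTop i] with n hn
    have hi : i ∈ Finset.range n := Finset.mem_range.2 hn
    rw [← Finset.mul_prod_erase _ _ hi, ← Finset.mul_prod_erase _ _ hi,
      ← Finset.mul_prod_erase _ _ hi]
    have e1 : ∏ j ∈ (Finset.range n).erase i, (Function.update p.u i t j - p.l j) =
        ∏ j ∈ (Finset.range n).erase i, (p.u j - p.l j) :=
      Finset.prod_congr rfl fun j hj => by simp [Finset.ne_of_mem_erase hj]
    have e2 : ∏ j ∈ (Finset.range n).erase i, (p.u j - Function.update p.l i t j) =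
        ∏ j ∈ (Finset.range n).erase i, (p.u j - p.l j) :=
      Finset.prod_congr rfl fun j hj => by simp [Finset.ne_of_mem_erase hj]
    rw [e1, e2, Function.update_self, Function.update_self]
    ring

/-- A set function bounding from above the volume of a box containing the given set. -/
noncomputable def preVol (S : Set (ℕ → ℝ)) : ℝ≥0∞ :=
  ⨅ (p : Box) (_ : S ⊆ p.carrier), ENNReal.ofReal p.vol

theorem preVol_empty : preVol ∅ = 0 := by
  refine le_antisymm ?_ zero_le
  refine (iInf₂_le (⟨0, 0, fun _ => le_rfl, by simp⟩ : Box)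
    (empty_subset _)).trans ?_
  simp [vol]

noncomputable def outer : OuterMeasure (ℕ → ℝ) := OuterMeasure.ofFunction preVol preVol_empty

theorem outer_le (p : Box) : outer p.carrier ≤ ENNReal.ofReal p.vol :=
  (OuterMeasure.ofFunction_le _).trans (iInf₂_le p (Subset.refl _))

theorem le_caratheodory : (MeasurableSpace.pi : MeasurableSpace (ℕ → ℝ)) ≤ outer.caratheodory := by
  refine iSup_le fun i => ?_
  have hb : Real.measurableSpace = MeasurableSpace.generateFrom (range Iio) :=
    (BorelSpace.measurable_eq (α := ℝ)).trans (borel_eq_generateFrom_Iio ℝ)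
  rw [hb, MeasurableSpace.comap_generateFrom]
  refine MeasurableSpace.generateFrom_le ?_
  rintro _ ⟨_, ⟨r, rfl⟩, rfl⟩
  refine OuterMeasure.ofFunction_caratheodory fun T => ?_
  refine le_iInf₂ fun p hp => ?_
  obtain ⟨q, q', h1, h2, h3⟩ := p.exists_split i r
  rw [← h3, ENNReal.ofReal_add q.vol_nonneg q'.vol_nonneg]
  exact add_le_add (iInf₂_le q ((inter_subset_inter_left _ hp).trans h1))
    (iInf₂_le q' ((sdiff_subset_sdiff_left hp).trans h2))

/-- A countably additive measure on `ℝ^ℕ` that gives a box the product of its side lengths. -/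
noncomputable def meas : Measure (ℕ → ℝ) := outer.toMeasure le_caratheodory

theorem le_outer (p : Box) : ENNReal.ofReal p.vol ≤ outer p.carrier := by
  rcases p.vol_nonneg.eq_or_lt with h0 | hpos
  · simp [← h0]
  have hlt : ∀ j, p.l j < p.u j := by
    intro j
    refine (p.le j).lt_of_ne fun h => hpos.ne' ?_
    refine tendsto_nhds_unique p.tendsto_vol (tendsto_const_nhds.congr' ?_)
    filter_upwards [eventually_gt_atTop j] with n hn
    exact (Finset.prod_eq_zero (Finset.mem_range.2 hn) (by rw [h, sub_self])).symm
  let ν : ℕ → Measure ℝ := fun j =>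
    (ENNReal.ofReal (p.u j - p.l j))⁻¹ • volume.restrict (Ico (p.l j) (p.u j))
  have hν : ∀ j, IsProbabilityMeasure (ν j) := fun j => ⟨by
    simp only [ν, Measure.smul_apply, Measure.restrict_apply_univ, Real.volume_Ico, smul_eq_mul]
    exact ENNReal.inv_mul_cancel (by simpa using hlt j) ENNReal.ofReal_ne_top⟩
  let P : Measure (ℕ → ℝ) := Measure.infinitePi ν
  have hP1 : P p.carrier = 1 := by
    have : p.carrier = Set.univ.pi fun j => Ico (p.l j) (p.u j) := by ext x; simp [carrier]
    rw [this, Measure.infinitePi_pi_univ _ (fun i => measurableSet_Ico)]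
    refine (tprod_congr fun j => ?_).trans tprod_one
    simp only [ν, Measure.smul_apply, Measure.restrict_apply_self, Real.volume_Ico, smul_eq_mul]
    exact ENNReal.inv_mul_cancel (by simpa using hlt j) ENNReal.ofReal_ne_top
  have hPq : ∀ q : Box, ENNReal.ofReal p.vol * P q.carrier ≤ ENNReal.ofReal q.vol := by
    intro q
    have hn : ∀ n, ENNReal.ofReal (∏ j ∈ Finset.range n, (p.u j - p.l j)) * P q.carrier ≤
        ENNReal.ofReal (∏ j ∈ Finset.range n, (q.u j - q.l j)) := by
      intro n
      have h1 : P q.carrier ≤ ∏ j ∈ Finset.range n,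
          ((ENNReal.ofReal (p.u j - p.l j))⁻¹ * ENNReal.ofReal (q.u j - q.l j)) := by
        refine (measure_mono (t := (Finset.range n : Set ℕ).pi fun j => Ico (q.l j) (q.u j))
          fun x (hx : ∀ j, _) j _ => hx j).trans ?_
        rw [Measure.infinitePi_pi _ (fun i _ => measurableSet_Ico)]
        refine Finset.prod_le_prod' fun j _ => ?_
        simp only [ν, Measure.smul_apply, smul_eq_mul]
        gcongr
        exact (Measure.restrict_apply_le _ _).trans (by rw [Real.volume_Ico])
      rw [ENNReal.ofReal_prod_of_nonneg fun j _ => sub_nonneg.2 (p.le j),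
        ENNReal.ofReal_prod_of_nonneg fun j _ => sub_nonneg.2 (q.le j)]
      refine (mul_le_mul_right h1 _).trans ?_
      rw [← Finset.prod_mul_distrib]
      refine Finset.prod_le_prod' fun j _ => ?_
      rw [← mul_assoc, ENNReal.mul_inv_cancel (by simpa using hlt j) ENNReal.ofReal_ne_top, one_mul]
    refine le_of_tendsto_of_tendsto' (b := atTop) ?_ ?_ hn
    · exact ENNReal.Tendsto.mul_const ((ENNReal.continuous_ofReal.tendsto _).comp p.tendsto_vol)
        (Or.inr (measure_ne_top _ _))
    · exact (ENNReal.continuous_ofReal.tendsto _).comp q.tendsto_vol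
  rw [outer, OuterMeasure.ofFunction_apply]
  refine le_iInf₂ fun t ht => ?_
  calc ENNReal.ofReal p.vol = ENNReal.ofReal p.vol * P p.carrier := by rw [hP1, mul_one]
    _ ≤ ENNReal.ofReal p.vol * ∑' n, P (t n) := by
        gcongr
        exact (measure_mono ht).trans (measure_iUnion_le _)
    _ = ∑' n, ENNReal.ofReal p.vol * P (t n) := ENNReal.tsum_mul_left.symm
    _ ≤ ∑' n, preVol (t n) := by
        refine ENNReal.tsum_le_tsum fun n => le_iInf₂ fun q hq => ?_
        exact (mul_le_mul_right (measure_mono hq) _).trans (hPq q)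

theorem meas_carrier (p : Box) : meas p.carrier = ENNReal.ofReal p.vol := by
  rw [meas, toMeasure_apply _ _ p.measurableSet]
  exact le_antisymm p.outer_le p.le_outer

end Box

section Existence

variable {E : Type*} [NormedAddCommGroup E] [InnerProductSpace ℝ E] (e : HilbertBasis ℕ ℝ E)

/-- Nonnegative square summable sequences, ordered pointwise. -/
abbrev Radius : Type := {r : ℕ → ℝ // (∀ j, 0 ≤ r j) ∧ Summable fun j => r j ^ 2}

instance : Nonempty Radius := ⟨⟨fun _ => 0, fun _ => le_rfl, by simp⟩⟩

instance : IsDirectedOrder Radius := ⟨fun r s =>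
  ⟨⟨fun j => max (r.1 j) (s.1 j), fun j => le_max_of_le_left (r.2.1 j),
    (r.2.2.add s.2.2).of_nonneg_of_le (fun j => sq_nonneg _) fun j => by
      beta_reduce
      rcases max_choice (r.1 j) (s.1 j) with h | h <;> rw [h] <;>
        linarith [sq_nonneg (r.1 j), sq_nonneg (s.1 j)]⟩,
    fun j => le_max_left _ _, fun j => le_max_right _ _⟩⟩

theorem exists_radius {f : ℕ → ℝ} (hf : Summable fun j => f j ^ 2) :
    ∃ r : Radius, ∀ j, |f j| ≤ r.1 j :=
  ⟨⟨fun j => |f j|, fun _ => abs_nonneg _, by simpa only [sq_abs] using hf⟩, fun _ => le_rfl⟩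

/-- The sequence `x` truncated at level `r`. -/
noncomputable def clip (x : ℕ → ℝ) (r : Radius) (j : ℕ) : ℝ := max (-r.1 j) (min (x j) (r.1 j))

theorem memℓp_clip (x : ℕ → ℝ) (r : Radius) : Memℓp (E := fun _ : ℕ => ℝ) (clip x r) 2 := by
  refine memℓp_gen (E := fun _ : ℕ => ℝ) ?_
  refine r.2.2.of_nonneg_of_le (fun j => by positivity) fun j => ?_
  have h : |clip x r j| ≤ r.1 j := abs_le.2
    ⟨le_max_left _ _, max_le (by linarith [r.2.1 j]) (min_le_right _ _)⟩
  rw [Real.norm_eq_abs, ENNReal.toReal_ofNat, Real.rpow_two]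
  exact pow_le_pow_left₀ (abs_nonneg _) h 2

/-- The vector of `E` with coordinates `clip x r`. -/
noncomputable def clipVec (x : ℕ → ℝ) (r : Radius) : E := e.repr.symm ⟨clip x r, memℓp_clip x r⟩

theorem inner_clipVec (x : ℕ → ℝ) (r : Radius) (j : ℕ) :
    inner ℝ (e j) (clipVec e x r) = clip x r j := by
  rw [← e.repr_apply_apply, clipVec, LinearIsometryEquiv.apply_symm_apply]

theorem summable_inner (z : E) : Summable fun j => inner ℝ (e j) z ^ 2 := by
  have h : (fun j => inner ℝ (e j) z ^ 2) = fun j => inner ℝ z (e j) * inner ℝ (e j) z := by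
    funext j
    rw [real_inner_comm, sq]
  rw [h]
  exact e.summable_inner_mul_inner z z

theorem eventually_mem {x a b : ℕ → ℝ} (hne : (block e a b).Nonempty)
    (hx : ∀ j, x j ∈ Ico (a j) (b j)) : ∀ᶠ r in atTop, clipVec e x r ∈ block e a b := by
  obtain ⟨z, hz⟩ := hne
  obtain ⟨r₀, hr₀⟩ := exists_radius (summable_inner e z)
  filter_upwards [eventually_ge_atTop r₀] with r hr j
  have hzr : |inner ℝ (e j) z| ≤ r.1 j := (hr₀ j).trans (hr j)
  have := hz j
  have hxj := hx j
  rw [inner_clipVec, clip, mem_Ico] at *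
  rw [abs_le] at hzr
  exact ⟨le_max_of_le_right (le_min hxj.1 (this.1.trans hzr.2)),
    max_lt (hzr.1.trans_lt this.2) (min_lt_of_left_lt hxj.2)⟩

theorem eventually_notMem {x a b : ℕ → ℝ} (hx : ¬ ∀ j, x j ∈ Ico (a j) (b j)) :
    ∀ᶠ r in atTop, clipVec e x r ∉ block e a b := by
  classical
  push Not at hx
  obtain ⟨j, hj⟩ := hx
  obtain ⟨r₀, hr₀⟩ := exists_radius (f := fun k => if k = j then x j else 0)
    (summable_of_ne_finset_zero (s := {j}) fun k hk => by simp at hk; simp [hk])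
  filter_upwards [eventually_ge_atTop r₀] with r hr hmem
  refine hj ?_
  have h1 := hmem j
  have h2 : |x j| ≤ r.1 j := by simpa using (hr₀ j).trans (hr j)
  rw [abs_le] at h2
  rwa [inner_clipVec, clip, min_eq_left h2.2, max_eq_right h2.1] at h1

/-- The subset of `ℝ^ℕ` corresponding to a subset of `E`. -/
def trace (A : Set E) : Set (ℕ → ℝ) := {x | ∀ᶠ r in atTop, clipVec e x r ∈ A}

/-- Sets for which `trace` is compatible with complements. -/
def traceable : Set (Set E) :=
  {A | (∀ x, (∀ᶠ r in atTop, clipVec e x r ∈ A) ∨ ∀ᶠ r in atTop, clipVec e x r ∉ A) ∧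
    MeasurableSet (trace e A) ∧ Box.meas (trace e A) ≠ ∞}

theorem trace_empty : trace e (∅ : Set E) = ∅ := by
  ext x
  simp only [trace, mem_empty_iff_false, mem_ofPred_eq, iff_false]
  exact fun h => h.exists.elim fun _ h => h

theorem trace_union {A B : Set E} (hA : A ∈ traceable e) :
    trace e (A ∪ B) = trace e A ∪ trace e B := by
  ext x
  constructor
  · intro h
    rcases hA.1 x with h1 | h1
    · exact Or.inl h1
    · refine Or.inr ?_
      filter_upwards [h, h1] with _ h2 h3 using h2.resolve_left h3
  · rintro (h | h)
    · exact h.mono fun r hr => Or.inl hr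
    · exact h.mono fun r hr => Or.inr hr

theorem trace_sdiff {A B : Set E} (hB : B ∈ traceable e) :
    trace e (A \ B) = trace e A \ trace e B := by
  ext x
  constructor
  · intro h
    refine ⟨h.mono fun r hr => hr.1, fun h' => ?_⟩
    obtain ⟨r, h1, h2⟩ := (h.and h').exists
    exact h1.2 h2
  · rintro ⟨h1, h2⟩
    filter_upwards [h1, (hB.1 x).resolve_left h2] with r h3 h4 using ⟨h3, h4⟩

theorem isSetRing_traceable : IsSetRing (traceable e) where
  empty_mem := by
    refine ⟨fun x => Or.inr (by simp), ?_, ?_⟩ <;> simp [trace_empty]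
  union_mem := fun A B hA hB => by
    refine ⟨fun x => ?_, ?_, ?_⟩
    · rcases hA.1 x with h | h
      · exact Or.inl (h.mono fun r hr => Or.inl hr)
      · rcases hB.1 x with h' | h'
        · exact Or.inl (h'.mono fun r hr => Or.inr hr)
        · exact Or.inr ((h.and h').mono fun r hr => by simpa using hr)
    · rw [trace_union e hA]; exact hA.2.1.union hB.2.1
    · rw [trace_union e hA]
      exact ((measure_union_le _ _).trans_lt (ENNReal.add_lt_top.2
        ⟨hA.2.2.lt_top, hB.2.2.lt_top⟩)).ne
  sdiff_mem := fun A B hA hB => by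
    refine ⟨fun x => ?_, ?_, ?_⟩
    · rcases hA.1 x with h | h
      · rcases hB.1 x with h' | h'
        · exact Or.inr (h'.mono fun r hr h2 => h2.2 hr)
        · exact Or.inl ((h.and h').mono fun r hr => hr)
      · exact Or.inr (h.mono fun r hr h2 => hr h2.1)
    · rw [trace_sdiff e hB]; exact hA.2.1.diff hB.2.1
    · rw [trace_sdiff e hB]
      exact ((measure_mono sdiff_subset).trans_lt hA.2.2.lt_top).ne

theorem trace_block {a b : ℕ → ℝ} (hne : (block e a b).Nonempty) :
    trace e (block e a b) = {x | ∀ j, x j ∈ Ico (a j) (b j)} := by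
  ext x
  by_cases hx : ∀ j, x j ∈ Ico (a j) (b j)
  · exact ⟨fun _ => hx, fun _ => eventually_mem e hne hx⟩
  · refine ⟨fun h => ?_, fun h => absurd h hx⟩
    obtain ⟨r, h1, h2⟩ := (h.and (eventually_notMem e hx)).exists
    exact absurd h1 h2

theorem exists_box {a b : ℕ → ℝ} (h : IsAbsMeasurableBlock e a b) (hne : (block e a b).Nonempty) :
    ∃ p : Box, trace e (block e a b) = p.carrier ∧ p.vol = blockVolume e a b := by
  have hs := h.summable.resolve_left hne.ne_empty
  refine ⟨⟨a, b, fun j => (h.lt j).le, hs⟩, trace_block e hne, ?_⟩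
  simp [Box.vol, blockVolume, hne]

theorem block_mem_traceable {a b : ℕ → ℝ} (h : IsAbsMeasurableBlock e a b) :
    block e a b ∈ traceable e := by
  rcases (block e a b).eq_empty_or_nonempty with h0 | hne
  · rw [h0]; exact (isSetRing_traceable e).empty_mem
  obtain ⟨p, hp, -⟩ := exists_box e h hne
  refine ⟨fun x => ?_, ?_, ?_⟩
  · by_cases hx : ∀ j, x j ∈ Ico (a j) (b j)
    · exact Or.inl (eventually_mem e hne hx)
    · exact Or.inr (eventually_notMem e hx)
  · rw [hp]; exact p.measurableSet
  · rw [hp, Box.meas_carrier]; exact ENNReal.ofReal_ne_top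

theorem blockRing_subset_traceable : blockRing e ⊆ traceable e := fun A hA =>
  hA _ (isSetRing_traceable e) (by rintro _ ⟨a, b, h, rfl⟩; exact block_mem_traceable e h)

/-- There is a finitely additive measure on the ring `r_𝓔` extending the volume of blocks. -/
theorem exists_content : ∃ m : AddContent ℝ≥0 (blockRing e),
    ∀ a b, IsAbsMeasurableBlock e a b → (m (block e a b) : ℝ) = blockVolume e a b := by
  refine ⟨(isSetRing_generatedRing _).addContent_of_union
    (fun A => (Box.meas (trace e A)).toNNReal) (by simp [trace_empty]) ?_, fun a b h => ?_⟩
  · intro A B hA hB hd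
    have hA' := blockRing_subset_traceable e hA
    have hB' := blockRing_subset_traceable e hB
    change (Box.meas (trace e (A ∪ B))).toNNReal = _
    rw [trace_union e hA', measure_union _ hB'.2.1, ENNReal.toNNReal_add hA'.2.2 hB'.2.2]
    rw [Set.disjoint_left]
    intro x h1 h2
    obtain ⟨r, h3, h4⟩ := (h1.and h2).exists
    exact Set.disjoint_left.1 hd h3 h4
  · change (((Box.meas (trace e (block e a b))).toNNReal : ℝ≥0) : ℝ) = _
    rcases (block e a b).eq_empty_or_nonempty with h0 | hne
    · simp [h0, trace_empty, blockVolume]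
    obtain ⟨p, hp, hv⟩ := exists_box e h hne
    rw [hp, Box.meas_carrier, ← hv]
    exact ENNReal.toReal_ofReal p.vol_nonneg

theorem inter_block {A B : Set E} (hA : ∃ a b, IsAbsMeasurableBlock e a b ∧ A = block e a b)
    (hB : ∃ a b, IsAbsMeasurableBlock e a b ∧ B = block e a b) :
    A ∩ B = ∅ ∨ ∃ a b, IsAbsMeasurableBlock e a b ∧ A ∩ B = block e a b := by
  obtain ⟨a, b, h, rfl⟩ := hA
  obtain ⟨a', b', h', rfl⟩ := hB
  rcases (block e a b ∩ block e a' b').eq_empty_or_nonempty with h0 | ⟨x, hx, hx'⟩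
  · exact Or.inl h0
  obtain ⟨M, hM⟩ := h.bounded_left
  obtain ⟨M', hM'⟩ := h'.bounded_left
  obtain ⟨N, hN⟩ := h.bounded_right
  obtain ⟨N', hN'⟩ := h'.bounded_right
  have hlt : ∀ j, max (a j) (a' j) < min (b j) (b' j) := fun j =>
    (max_le (hx j).1 (hx' j).1).trans_lt (lt_min (hx j).2 (hx' j).2)
  refine Or.inr ⟨fun j => max (a j) (a' j), fun j => min (b j) (b' j),
    ⟨⟨max M M', ?_⟩, ⟨max N N', ?_⟩, hlt, Or.inr ?_⟩, ?_⟩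
  · rintro _ ⟨j, rfl⟩
    exact abs_max_le_max_abs_abs.trans (max_le_max (hM ⟨j, rfl⟩) (hM' ⟨j, rfl⟩))
  · rintro _ ⟨j, rfl⟩
    exact abs_min_le_max_abs_abs.trans (max_le_max (hN ⟨j, rfl⟩) (hN' ⟨j, rfl⟩))
  · have hs := h.summable.resolve_left (Set.Nonempty.ne_empty ⟨x, hx⟩)
    refine Summable.of_nonneg_of_le (fun j => le_max_left _ _) (fun j => ?_) hs
    refine max_le_max le_rfl (Real.log_le_log (sub_pos.2 (hlt j)) ?_)
    exact sub_le_sub (min_le_left _ _) (le_max_left _ _)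
  · ext y
    simp only [block, mem_inter_iff, mem_ofPred_eq, mem_Ico, max_le_iff, lt_min_iff]
    exact ⟨fun h j => ⟨⟨(h.1 j).1, (h.2 j).1⟩, ⟨(h.1 j).2, (h.2 j).2⟩⟩,
      fun h => ⟨fun j => ⟨(h j).1.1, (h j).2.1⟩, fun j => ⟨(h j).1.2, (h j).2.2⟩⟩⟩

/-- Any two finitely additive measures on the ring `r_𝓔` extending the volume of blocks agree on
all sets of the ring. -/
theorem content_unique (m m' : AddContent ℝ≥0 (blockRing e))
    (hm : ∀ a b, IsAbsMeasurableBlock e a b → (m (block e a b) : ℝ) = blockVolume e a b)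
    (hm' : ∀ a b, IsAbsMeasurableBlock e a b → (m' (block e a b) : ℝ) = blockVolume e a b) :
    ∀ A ∈ blockRing e, m A = m' A := by
  refine FinAddMeasure.content_eq_of_generatedRing (fun A hA B hB => inter_block e hA hB) m m' ?_
  rintro _ ⟨a, b, h, rfl⟩
  exact NNReal.coe_injective ((hm a b h).trans (hm' a b h).symm)

end Existence

end BlockMeasure

section SquareIntegrable

variable {E : Type*} [NormedAddCommGroup E] [InnerProductSpace ℝ E]

/-- The finitely additive measure `λ_𝓔` on the ring `r_𝓔`: the unique one (existence is
`BlockMeasure.exists_content`, uniqueness is `BlockMeasure.content_unique`) for which the measure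
of every absolutely measurable block is its volume. -/
noncomputable def ringMeasure (e : HilbertBasis ℕ ℝ E) : FinAddMeasure E where
  ring := blockRing e
  isSetRing := isSetRing_generatedRing _
  content := (BlockMeasure.exists_content e).choose

/-- The finitely additive measure `λ_𝓔` on the completed ring `𝓡_𝓔`. -/
noncomputable def shiftMeasure (e : HilbertBasis ℕ ℝ E) : FinAddMeasure E :=
  (ringMeasure e).completion

/-- The Hilbert space `𝓗_𝓔` of functions that are square integrable with respect to `λ_𝓔`. -/
abbrev HE (e : HilbertBasis ℕ ℝ E) : Type _ := (shiftMeasure e).L2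

theorem block_mem_ring {e : HilbertBasis ℕ ℝ E} {a b : ℕ → ℝ} (h : IsAbsMeasurableBlock e a b) :
    block e a b ∈ (shiftMeasure e).ring :=
  FinAddMeasure.ring_subset_completion (subset_generatedRing _ ⟨a, b, h, rfl⟩)

/-- The indicator function of an absolutely measurable block, as an element of `𝓗_𝓔`. -/
noncomputable def blockVec {e : HilbertBasis ℕ ℝ E} {a b : ℕ → ℝ}
    (h : IsAbsMeasurableBlock e a b) : HE e :=
  (shiftMeasure e).indicator (block e a b) (block_mem_ring h)

end SquareIntegrable

section PartialFourier

variable {E : Type*} [NormedAddCommGroup E] [InnerProductSpace ℝ E]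

/-- The subspace `E^n`: the orthogonal complement of the span of the first `n` basis vectors. -/
noncomputable def tail (e : HilbertBasis ℕ ℝ E) (n : ℕ) : Submodule ℝ E :=
  (Submodule.span ℝ ((fun j => e j) '' Iio n))ᗮ

theorem basis_mem_tail (e : HilbertBasis ℕ ℝ E) (n j : ℕ) : e (n + j) ∈ tail e n := by
  rw [tail, Submodule.mem_orthogonal]
  intro x hx
  induction hx using Submodule.span_induction with
  | mem x hx =>
    obtain ⟨k, hk, rfl⟩ := hx
    have hk' : k < n := hk
    exact e.orthonormal.2 (by omega)
  | zero => exact inner_zero_left _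
  | add x y _ _ hx hy => rw [inner_add_left, hx, hy, add_zero]
  | smul c x _ hx => rw [inner_smul_left, hx, mul_zero]

theorem inner_basis_tail (e : HilbertBasis ℕ ℝ E) {n k : ℕ} (hk : k < n) (y : tail e n) :
    inner ℝ (e k) (y : E) = 0 :=
  (Submodule.mem_orthogonal _ _).1 y.2 _ (Submodule.subset_span ⟨k, hk, rfl⟩)

theorem orthonormal_tail (e : HilbertBasis ℕ ℝ E) (n : ℕ) :
    Orthonormal ℝ fun j => (⟨e (n + j), basis_mem_tail e n j⟩ : tail e n) :=
  ⟨fun j => e.orthonormal.1 (n + j), fun i j hij => e.orthonormal.2 (by omega)⟩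

theorem span_tail_orthogonal (e : HilbertBasis ℕ ℝ E) (n : ℕ) :
    (Submodule.span ℝ (range fun j => (⟨e (n + j), basis_mem_tail e n j⟩ : tail e n)))ᗮ = ⊥ := by
  rw [Submodule.eq_bot_iff]
  intro y hy
  have h : ∀ k, inner ℝ (e k) (y : E) = 0 := by
    intro k
    rcases lt_or_ge k n with hk | hk
    · exact inner_basis_tail e hk y
    · have := (Submodule.mem_orthogonal _ _).1 hy _ (Submodule.subset_span ⟨k - n, rfl⟩)
      simpa [Submodule.coe_inner, Nat.add_sub_cancel' hk] using this
  have h2 : e.repr (y : E) = 0 := by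
    ext k
    rw [e.repr_apply_apply, h k]
    rfl
  exact Subtype.ext ((map_eq_zero_iff e.repr e.repr.injective).1 h2)

variable [CompleteSpace E]

instance completeSpace_tail (e : HilbertBasis ℕ ℝ E) (n : ℕ) : CompleteSpace (tail e n) :=
  inferInstanceAs (CompleteSpace ((Submodule.span ℝ ((fun j => e j) '' Iio n))ᗮ : Submodule ℝ E))

/-- The orthonormal basis `𝓔^n` of `E^n`: the basis vectors of `E` after the first `n`. -/
noncomputable def tailBasis (e : HilbertBasis ℕ ℝ E) (n : ℕ) : HilbertBasis ℕ ℝ (tail e n) :=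
  HilbertBasis.mkOfOrthogonalEqBot (orthonormal_tail e n) (span_tail_orthogonal e n)

theorem tailBasis_apply (e : HilbertBasis ℕ ℝ E) (n j : ℕ) :
    (tailBasis e n j : E) = e (n + j) := by
  rw [tailBasis, HilbertBasis.coe_mkOfOrthogonalEqBot]

theorem inner_tailBasis (e : HilbertBasis ℕ ℝ E) (n j : ℕ) (y : tail e n) :
    inner ℝ (tailBasis e n j) y = inner ℝ (e (n + j)) (y : E) := by
  rw [Submodule.coe_inner, tailBasis_apply]

/-- Dropping the first `n` sides of an absolutely measurable block of `E` gives one of `E^n`. -/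
theorem IsAbsMeasurableBlock.tail {e : HilbertBasis ℕ ℝ E} {a b : ℕ → ℝ}
    (h : IsAbsMeasurableBlock e a b) (n : ℕ) :
    IsAbsMeasurableBlock (tailBasis e n) (fun j => a (n + j)) (fun j => b (n + j)) where
  bounded_left := h.bounded_left.mono (by rintro _ ⟨j, rfl⟩; exact ⟨n + j, rfl⟩)
  bounded_right := h.bounded_right.mono (by rintro _ ⟨j, rfl⟩; exact ⟨n + j, rfl⟩)
  lt := fun j => h.lt (n + j)
  summable := by
    rcases h.summable with h0 | hs
    · left
      rw [eq_empty_iff_forall_notMem] at h0 ⊢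
      intro y hy
      refine h0 ((y : E) + ∑ i ∈ Finset.range n, a i • e i) fun j => ?_
      have hsum : inner ℝ (e j) (∑ i ∈ Finset.range n, a i • e i) = if j < n then a j else 0 := by
        simp only [inner_sum, inner_smul_right, orthonormal_iff_ite.1 e.orthonormal]
        simp
      rw [inner_add_right, hsum]
      by_cases hj : j < n
      · rw [if_pos hj, inner_basis_tail e hj, zero_add]
        exact ⟨le_rfl, h.lt j⟩
      · have := hy (j - n)
        rw [inner_tailBasis] at this
        simpa [hj, Nat.add_sub_cancel' (not_lt.1 hj)] using this
    · right
      exact hs.comp_injective (add_right_injective n)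

/-- The space `L_2(E_n)`, where `E_n` is identified with `ℝ^n` by the basis vectors. -/
abbrev L2Head (n : ℕ) : Type := Lp ℂ 2 (volume : Measure (EuclideanSpace ℝ (Fin n)))

/-- The box `∏_{i < n} [a_i, b_i)` in `ℝ^n`. -/
def headBox (n : ℕ) (a b : ℕ → ℝ) : Set (EuclideanSpace ℝ (Fin n)) :=
  {y | ∀ i : Fin n, y i ∈ Ico (a i) (b i)}

theorem headBox_eq (n : ℕ) (a b : ℕ → ℝ) : headBox n a b =
    (MeasurableEquiv.toLp 2 (Fin n → ℝ)).symm ⁻¹' (univ.pi fun i : Fin n => Ico (a i) (b i)) := by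
  ext y
  simp [headBox]

theorem measurableSet_headBox (n : ℕ) (a b : ℕ → ℝ) : MeasurableSet (headBox n a b) := by
  rw [headBox_eq]
  exact (MeasurableEquiv.toLp 2 (Fin n → ℝ)).symm.measurable
    (MeasurableSet.univ_pi fun _ => measurableSet_Ico)

theorem volume_headBox_ne_top (n : ℕ) (a b : ℕ → ℝ) : volume (headBox n a b) ≠ ∞ := by
  rw [headBox_eq, (EuclideanSpace.volume_preserving_symm_measurableEquiv_toLp
    (Fin n)).measure_preimage_equiv, Real.volume_pi_Ico]
  exact ENNReal.prod_ne_top fun i _ => ENNReal.ofReal_ne_top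

/-- The indicator function of a box, as an element of `L_2(E_n)`. -/
noncomputable def headBoxVec (n : ℕ) (a b : ℕ → ℝ) : L2Head n :=
  indicatorConstLp 2 (measurableSet_headBox n a b) (volume_headBox_ne_top n a b) (1 : ℂ)

/-- The Hilbert space tensor product `L_2(E_n) ⊗ 𝓗_{𝓔^n}`. -/
abbrev HeadTail (e : HilbertBasis ℕ ℝ E) (n : ℕ) : Type _ :=
  UniformSpace.Completion (L2Head n ⊗[ℂ] HE (tailBasis e n))

/-- `U` is the identification `L_2(E_n) ⊗ 𝓗_{𝓔^n} = 𝓗_𝓔`: the unitary map sending the tensor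
product of the indicator functions of a box and a block to the indicator function of their
product. -/
def IsIdentification (e : HilbertBasis ℕ ℝ E) (n : ℕ) (U : HeadTail e n ≃ₗᵢ[ℂ] HE e) : Prop :=
  ∀ (a b : ℕ → ℝ) (h : IsAbsMeasurableBlock e a b),
    U ((headBoxVec n a b ⊗ₜ[ℂ] blockVec (h.tail n) : L2Head n ⊗[ℂ] HE (tailBasis e n)) :
      HeadTail e n) = blockVec h

/-- `Φ` is the unitary Fourier transform of `L_2(ℝ^n)`, given on integrable functions by
`(Φ f)(ξ) = (2π)^{-n/2} ∫ exp(-i (x, ξ)) f(x) dx`. -/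
def IsUnitaryFourier (n : ℕ) (Φ : L2Head n ≃ₗᵢ[ℂ] L2Head n) : Prop :=
  ∀ f : L2Head n, Integrable f volume → (Φ f : EuclideanSpace ℝ (Fin n) → ℂ) =ᵐ[volume] fun ξ =>
    (((2 * Real.pi) ^ (-(n : ℝ) / 2) : ℝ) : ℂ) *
      ∫ x, Complex.exp (-Complex.I * (inner ℝ x ξ : ℝ)) * f x

/-- `T` is the partial Fourier transform `𝓕_n = 𝓕_{E_n} ⊗ I` in the first `n` variables. -/
def IsPartialFourier (e : HilbertBasis ℕ ℝ E) (n : ℕ) (T : HE e →L[ℂ] HE e) : Prop :=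
  ∃ (Φ : L2Head n ≃ₗᵢ[ℂ] L2Head n) (U : HeadTail e n ≃ₗᵢ[ℂ] HE e),
    IsUnitaryFourier n Φ ∧ IsIdentification e n U ∧
      ∀ (f : L2Head n) (g : HE (tailBasis e n)),
        T (U ((f ⊗ₜ[ℂ] g : L2Head n ⊗[ℂ] HE (tailBasis e n)) : HeadTail e n)) =
          U ((Φ f ⊗ₜ[ℂ] g : L2Head n ⊗[ℂ] HE (tailBasis e n)) : HeadTail e n)

end PartialFourier

end QuantumWalk

/-!
The indicator functions of absolutely measurable blocks are total in `𝓗_𝓔`, because the indicator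
function of a set of the generated ring is a linear combination of them and the completion only
adds sets that are limits of sets of the ring (`isTotal_blockVec`). Likewise the indicator
functions of boxes are total in `L_2(ℝ^n)` (`isTotal_headBoxVec`). The volume of a block is the
volume of its head, a box in `ℝ^n`, times that of its tail (`blockVolume_eq_mul`). So the total
families `χ_A ⊗ χ_B` and `χ_{A × B}` have the same Gram matrix, and there is exactly one unitary map
taking one to the other (`exists_isIdentification`, `IsIdentification.unique`).

The unitary Fourier transform of `L_2(ℝ^n)` in the stated normalization is Mathlib's followed by a
unitary dilation by `(2π)⁻¹`. It is characterized by its integral formula, which covers the indicator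
functions of boxes (`exists_isUnitaryFourier`, `IsUnitaryFourier.unique`). Conjugating `Φ ⊗ I` with
the identification gives the operators `𝓕_n`.

Since the `𝓕_n` are isometries, weak convergence to zero need only be checked on the block vectors
(`IsTotal.tendsto_inner_zero`). Write a block vector as `h_n ⊗ t_n`, with `h_n` the indicator function
of a box of volume `V_n = ‖h_n‖²`, so that its norm is `‖h_n‖ ‖t_n‖`. The Fourier transform of `h_n`
is bounded by `(2π)^{-n/2} V_n`, hence the matrix element between two block vectors `v`, `v'` is at
most `(2π)^{-n/2} V_n V'_n ‖t_n‖ ‖t'_n‖ = (2π)^{-n/2} √V_n √V'_n ‖v‖ ‖v'‖`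
(`IsPartialFourier.norm_inner_le`). For nonempty blocks the volumes `V_n` are the partial products
of a convergent infinite product, hence bounded, and the factor `(2π)^{-n/2}` tends to zero. The
vector of an empty block is zero.
-/

namespace QuantumWalk

/-! ### Total families in Hilbert spaces -/

section Total

variable {ι ι' X Y : Type*} [NormedAddCommGroup X] [InnerProductSpace ℂ X]
  [NormedAddCommGroup Y] [InnerProductSpace ℂ Y]

/-- A family of vectors is total if its linear combinations are dense. -/
def IsTotal (x : ι → X) : Prop :=
  Dense (Submodule.span ℂ (range x) : Set X)

theorem IsTotal.of_forall_inner [CompleteSpace X] {x : ι → X}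
    (h : ∀ v, (∀ i, inner ℂ (x i) v = 0) → v = 0) : IsTotal x := by
  rw [IsTotal, Submodule.dense_iff_topologicalClosure_eq_top,
    Submodule.topologicalClosure_eq_top_iff, Submodule.eq_bot_iff]
  intro v hv
  exact h v fun i => (Submodule.mem_orthogonal _ _).1 hv _ (Submodule.subset_span ⟨i, rfl⟩)

theorem IsTotal.forall_mem {x : ι → X} (hx : IsTotal x) (V : Submodule ℂ X)
    (hV : IsClosed (V : Set X)) (h : ∀ i, x i ∈ V) (v : X) : v ∈ V := by
  have h1 : (Submodule.span ℂ (range x) : Set X) ⊆ V :=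
    Submodule.span_le.2 (by rintro _ ⟨i, rfl⟩; exact h i)
  have h2 := closure_minimal h1 hV
  rw [hx.closure_eq] at h2
  exact h2 (mem_univ v)

theorem IsTotal.of_range_subset {x : ι → X} {y : ι' → X} (hx : IsTotal x)
    (h : range x ⊆ range y) : IsTotal y :=
  Dense.mono (Submodule.span_mono h) hx

/-- Continuous linear maps are determined by their values on a total family. -/
theorem IsTotal.ext {x : ι → X} (hx : IsTotal x) {f g : X →L[ℂ] Y}
    (h : ∀ i, f (x i) = g (x i)) : f = g := by
  ext v
  exact hx.forall_mem (LinearMap.eqLocus (f : X →ₗ[ℂ] Y) g)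
    (isClosed_eq f.continuous g.continuous) h v

/-- Two total families with the same Gram matrix are related by a unitary map. -/
theorem IsTotal.exists_linearIsometryEquiv [CompleteSpace X] [CompleteSpace Y] {x : ι → X}
    {y : ι → Y} (hx : IsTotal x) (hy : IsTotal y)
    (h : ∀ i j, inner ℂ (y i) (y j) = inner ℂ (x i) (x j)) :
    ∃ U : X ≃ₗᵢ[ℂ] Y, ∀ i, U (x i) = y i := by
  have d1 : DenseRange (Finsupp.linearCombination ℂ x) := by
    rw [IsTotal, ← Finsupp.range_linearCombination] at hx
    exact hx
  have d2 : DenseRange (Finsupp.linearCombination ℂ y) := by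
    rw [IsTotal, ← Finsupp.range_linearCombination] at hy
    exact hy
  have hn : ∀ c, ‖Finsupp.linearCombination ℂ y (LinearEquiv.refl ℂ (ι →₀ ℂ) c)‖ =
      ‖Finsupp.linearCombination ℂ x c‖ := by
    intro c
    have : inner ℂ (Finsupp.linearCombination ℂ y c) (Finsupp.linearCombination ℂ y c) =
        inner ℂ (Finsupp.linearCombination ℂ x c) (Finsupp.linearCombination ℂ x c) := by
      simp only [Finsupp.linearCombination_apply, Finsupp.sum, sum_inner, inner_sum,
        inner_smul_left, inner_smul_right, h]
    rw [LinearEquiv.refl_apply, norm_eq_sqrt_re_inner (𝕜 := ℂ), this,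
      ← norm_eq_sqrt_re_inner (𝕜 := ℂ)]
  refine ⟨(LinearEquiv.refl ℂ (ι →₀ ℂ)).extendOfIsometry (Finsupp.linearCombination ℂ x)
    (Finsupp.linearCombination ℂ y) d1 d2 hn, fun i => ?_⟩
  have := LinearEquiv.extendOfIsometry_eq (LinearEquiv.refl ℂ (ι →₀ ℂ))
    (Finsupp.linearCombination ℂ x) (Finsupp.linearCombination ℂ y) d1 d2 hn (Finsupp.single i 1)
  simpa using this

/-- Uniformly bounded functionals that tend to zero on a total family tend to zero everywhere. -/
theorem IsTotal.tendsto_zero {x : ι → X} (hx : IsTotal x) {f : ℕ → X →L[ℂ] ℂ} {M : ℝ}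
    (hM : ∀ n, ‖f n‖ ≤ M) (h : ∀ i, Tendsto (fun n => f n (x i)) atTop (𝓝 0)) (v : X) :
    Tendsto (fun n => f n v) atTop (𝓝 0) := by
  let V : Submodule ℂ X :=
    { carrier := {v | Tendsto (fun n => f n v) atTop (𝓝 0)}
      add_mem' := fun {a b} ha hb => by simpa using! Tendsto.add ha hb
      zero_mem' := by simp
      smul_mem' := fun c a ha => by simpa using! Tendsto.const_smul ha c }
  refine hx.forall_mem V ?_ h v
  refine isClosed_of_closure_subset fun v hv => ?_
  have hM0 : 0 ≤ M := (norm_nonneg _).trans (hM 0)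
  change Tendsto (fun n => f n v) atTop (𝓝 0)
  rw [Metric.tendsto_atTop]
  intro ε hε
  obtain ⟨w, hw, hvw⟩ := Metric.mem_closure_iff.1 hv (ε / 2 / (M + 1)) (by positivity)
  obtain ⟨N, hN⟩ := Metric.tendsto_atTop.1 hw (ε / 2) (half_pos hε)
  refine ⟨N, fun n hn => ?_⟩
  have h1 := hN n hn
  rw [dist_zero_right] at h1 ⊢
  have h2 : ‖f n (v - w)‖ ≤ (M + 1) * ‖v - w‖ :=
    ((f n).le_opNorm _).trans (by gcongr; linarith [hM n])
  rw [dist_eq_norm, lt_div_iff₀ (by positivity)] at hvw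
  calc ‖f n v‖ = ‖f n (v - w) + f n w‖ := by rw [map_sub, sub_add_cancel]
    _ ≤ ‖f n (v - w)‖ + ‖f n w‖ := norm_add_le _ _
    _ < ε := by linarith

/-- Weak convergence of contractions to zero can be tested on a total family. -/
theorem IsTotal.tendsto_inner_zero {x : ι → X} (hx : IsTotal x) {F : ℕ → X →L[ℂ] X}
    (hF : ∀ n v, ‖F n v‖ ≤ ‖v‖)
    (h : ∀ i j, Tendsto (fun n => inner ℂ (x i) (F n (x j))) atTop (𝓝 0)) (u v : X) :
    Tendsto (fun n => inner ℂ u (F n v)) atTop (𝓝 0) := by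
  have h1 : ∀ i v, Tendsto (fun n => inner ℂ (x i) (F n v)) atTop (𝓝 0) := fun i v => by
    refine hx.tendsto_zero (f := fun n => (innerSL ℂ (x i)).comp (F n)) (M := ‖x i‖) ?_ (h i) v
    refine fun n => ContinuousLinearMap.opNorm_le_bound _ (norm_nonneg _) fun w => ?_
    exact (norm_inner_le_norm _ _).trans (by gcongr; exact hF n w)
  have h2 : Tendsto (fun n => inner ℂ (F n v) u) atTop (𝓝 0) := by
    refine hx.tendsto_zero (f := fun n => innerSL ℂ (F n v)) (M := ‖v‖) ?_ (fun i => ?_) u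
    · intro n
      rw [innerSL_apply_norm]
      exact hF n v
    · have := (Complex.continuous_conj.tendsto 0).comp (h1 i v)
      rw [map_zero] at this
      exact this.congr fun n => inner_conj_symm _ _
  have := (Complex.continuous_conj.tendsto 0).comp h2
  rw [map_zero] at this
  exact this.congr fun n => inner_conj_symm _ _

end Total

/-! ### Completed tensor products -/

section Tensor

variable {ι ι' X Y : Type*} [NormedAddCommGroup X] [InnerProductSpace ℂ X]
  [NormedAddCommGroup Y] [InnerProductSpace ℂ Y]

/-- The tensor products of the members of two total families are total in the completed tensor
product. -/
theorem IsTotal.tmul {x : ι → X} {y : ι' → Y} (hx : IsTotal x) (hy : IsTotal y) :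
    IsTotal fun p : ι × ι' =>
      ((x p.1 ⊗ₜ[ℂ] y p.2 : X ⊗[ℂ] Y) : UniformSpace.Completion (X ⊗[ℂ] Y)) := by
  set V := (Submodule.span ℂ (range fun p : ι × ι' =>
      ((x p.1 ⊗ₜ[ℂ] y p.2 : X ⊗[ℂ] Y) : UniformSpace.Completion (X ⊗[ℂ] Y)))).topologicalClosure
    with hV
  let J : X ⊗[ℂ] Y →L[ℂ] UniformSpace.Completion (X ⊗[ℂ] Y) := UniformSpace.Completion.toComplL
  have hc : IsClosed (V : Set (UniformSpace.Completion (X ⊗[ℂ] Y))) :=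
    Submodule.isClosed_topologicalClosure _
  have h1 : ∀ i b, J (x i ⊗ₜ[ℂ] b) ∈ V := fun i b => by
    let K : Y →L[ℂ] UniformSpace.Completion (X ⊗[ℂ] Y) := J.comp (TensorProduct.mkL ℂ X Y (x i))
    refine hy.forall_mem (V.comap K.toLinearMap) (hc.preimage K.continuous) (fun k => ?_) b
    exact subset_closure (Submodule.subset_span ⟨(i, k), rfl⟩)
  have h2 : ∀ a b, J (a ⊗ₜ[ℂ] b) ∈ V := fun a b => by
    let K : X →L[ℂ] UniformSpace.Completion (X ⊗[ℂ] Y) := J.comp ((TensorProduct.mkL ℂ X Y).flip b)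
    refine hx.forall_mem (V.comap K.toLinearMap) (hc.preimage K.continuous) (fun k => ?_) a
    exact h1 k b
  have h3 : ∀ t, J t ∈ V := fun t => by
    induction t using TensorProduct.induction_on with
    | zero => rw [map_zero]; exact V.zero_mem
    | tmul a b => exact h2 a b
    | add a b ha hb => rw [map_add]; exact V.add_mem ha hb
  rw [IsTotal, Submodule.dense_iff_topologicalClosure_eq_top, ← hV, Submodule.eq_top_iff']
  intro w
  induction w using UniformSpace.Completion.induction_on with
  | hp => exact hc
  | ih t => exact h3 t

theorem isTotal_id : IsTotal (id : X → X) := by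
  simp [IsTotal]

/-- The operator `Φ ⊗ I` on the completed tensor product, for unitary `Φ`. -/
theorem exists_completion_rTensor (Φ : X ≃ₗᵢ[ℂ] X) :
    ∃ W : UniformSpace.Completion (X ⊗[ℂ] Y) ≃ₗᵢ[ℂ] UniformSpace.Completion (X ⊗[ℂ] Y),
      ∀ a b, W ((a ⊗ₜ[ℂ] b : X ⊗[ℂ] Y) : UniformSpace.Completion (X ⊗[ℂ] Y)) =
        ((Φ a ⊗ₜ[ℂ] b : X ⊗[ℂ] Y) : UniformSpace.Completion (X ⊗[ℂ] Y)) := by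
  have hΦ : IsTotal (Φ : X → X) := by
    rw [IsTotal, Φ.surjective.range_eq, Submodule.span_univ]
    exact dense_univ
  have t1 := (isTotal_id (X := X)).tmul (isTotal_id (X := Y))
  have t2 := hΦ.tmul (isTotal_id (X := Y))
  obtain ⟨W, hW⟩ := t1.exists_linearIsometryEquiv t2 fun p q => by
    rw [UniformSpace.Completion.inner_coe, UniformSpace.Completion.inner_coe,
      TensorProduct.inner_tmul, TensorProduct.inner_tmul, Φ.inner_map_map]
    rfl
  exact ⟨W, fun a b => hW (a, b)⟩

end Tensor

/-! ### The Fourier transform of square integrable functions -/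

section Fourier

open FourierTransform

/-- On square integrable functions that are also integrable, the unitary Fourier transform is given
by the Fourier integral: both define the same tempered distribution. -/
theorem fourier_Lp_two_ae_eq {V : Type*} [NormedAddCommGroup V] [InnerProductSpace ℝ V]
    [FiniteDimensional ℝ V] [MeasurableSpace V] [BorelSpace V]
    (f : Lp ℂ 2 (volume : Measure V)) (hf : Integrable f volume) :
    ((𝓕 f : Lp ℂ 2 (volume : Measure V)) : V → ℂ) =ᵐ[volume] 𝓕 (f : V → ℂ) := by
  have hc : Continuous (𝓕 (f : V → ℂ)) :=
    VectorFourier.fourierIntegral_continuous Real.continuous_fourierChar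
      (innerSL ℝ).continuous₂ hf
  refine ae_eq_of_integral_contDiff_smul_eq
    ((Lp.memLp (𝓕 f : Lp ℂ 2 (volume : Measure V))).locallyIntegrable one_le_two)
    hc.locallyIntegrable fun g hg hgc => ?_
  -- Test functions are Schwartz functions, to which the Fourier transform can be moved.
  have h1 : HasCompactSupport (Complex.ofRealCLM ∘ g) := hgc.comp_left rfl
  have h2 : ContDiff ℝ ((⊤ : ℕ∞) : WithTop ℕ∞) (Complex.ofRealCLM ∘ g) :=
    Complex.ofRealCLM.contDiff.comp hg
  set φ := h1.toSchwartzMap h2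
  have e1 := congrArg (fun T : TemperedDistribution V ℂ => T φ)
    (Lp.fourier_toTemperedDistribution_eq (E := V) (F := ℂ) f)
  simp only [TemperedDistribution.fourier_apply,
    Lp.toTemperedDistribution_apply (μ := (volume : Measure V)) (p := 2)] at e1
  have e2 := VectorFourier.integral_fourierIntegral_smul_eq_flip (L := innerₗ V)
    Real.continuous_fourierChar continuous_inner
    (φ.integrable (μ := (volume : Measure V))) hf
  rw [flip_innerₗ] at e2
  have e3 : ∀ x, φ x = (g x : ℂ) := fun x => rfl
  have e4 : ∀ (x : V) (z : ℂ), g x • z = φ x • z := fun x z => by rw [e3]; simp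
  simp only [e4]
  rw [← e1]
  exact e2

section Dilation

variable {V : Type*} [NormedAddCommGroup V] [InnerProductSpace ℝ V]
  [FiniteDimensional ℝ V] [MeasurableSpace V] [BorelSpace V]

theorem quasiMeasurePreserving_smul {r : ℝ} (hr : 0 < r) :
    Measure.QuasiMeasurePreserving (fun x : V => r • x) := by
  refine ⟨measurable_const_smul r, ?_⟩
  rw [Measure.map_addHaar_smul _ hr.ne']
  exact Measure.smul_absolutelyContinuous

theorem memLp_comp_smul {r : ℝ} (hr : 0 < r) (f : Lp ℂ 2 (volume : Measure V)) (c : ℂ) :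
    MemLp (fun x => c * f (r • x)) 2 (volume : Measure V) := by
  refine MemLp.const_mul ?_ c
  refine MemLp.comp_of_map (f := fun x : V => r • x) ?_ (measurable_const_smul r).aemeasurable
  rw [Measure.map_addHaar_smul _ hr.ne']
  exact (Lp.memLp f).smul_measure ENNReal.ofReal_ne_top

variable (V) in
/-- The dilation by a positive factor, normalized so as to be unitary. -/
theorem exists_dilation {r : ℝ} (hr : 0 < r) :
    ∃ D : Lp ℂ 2 (volume : Measure V) ≃ₗᵢ[ℂ] Lp ℂ 2 (volume : Measure V),
      ∀ f : Lp ℂ 2 (volume : Measure V), (D f : V → ℂ) =ᵐ[volume]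
        fun x => ((r ^ ((Module.finrank ℝ V : ℝ) / 2) : ℝ) : ℂ) * f (r • x) := by
  let d : ℝ → ℝ := fun r => r ^ ((Module.finrank ℝ V : ℝ) / 2)
  let D : ∀ r : ℝ, 0 < r → Lp ℂ 2 (volume : Measure V) → Lp ℂ 2 (volume : Measure V) :=
    fun r hr f => (memLp_comp_smul hr f (d r : ℂ)).toLp _
  have hD : ∀ r (hr : 0 < r) f, (D r hr f : V → ℂ) =ᵐ[volume] fun x => (d r : ℂ) * f (r • x) :=
    fun r hr f => MemLp.coeFn_toLp _
  have hsurj : Function.Surjective (D r hr) := fun f => by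
    refine ⟨D r⁻¹ (inv_pos.2 hr) f, Lp.ext ?_⟩
    have h1 := (quasiMeasurePreserving_smul (V := V) hr).ae (hD r⁻¹ (inv_pos.2 hr) f)
    filter_upwards [hD r hr (D r⁻¹ (inv_pos.2 hr) f), h1] with x hx hx1
    rw [hx, hx1, smul_smul, inv_mul_cancel₀ hr.ne', one_smul, ← mul_assoc, ← Complex.ofReal_mul]
    simp only [d]
    rw [← Real.mul_rpow hr.le (inv_pos.2 hr).le, mul_inv_cancel₀ hr.ne', Real.one_rpow]
    simp
  have htot : IsTotal (D r hr) := by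
    rw [IsTotal, hsurj.range_eq, Submodule.span_univ]
    exact dense_univ
  -- A surjection that preserves inner products is linear, so only the inner products matter.
  obtain ⟨T, hT⟩ := isTotal_id.exists_linearIsometryEquiv htot fun f g => by
    rw [L2.inner_def, L2.inner_def]
    have h1 : ∫ x, inner ℂ (D r hr f x) (D r hr g x) =
        ∫ x, ((d r ^ 2 : ℝ) : ℂ) * inner ℂ (f (r • x)) (g (r • x)) := by
      refine integral_congr_ae ?_
      filter_upwards [hD r hr f, hD r hr g] with x hf hg
      rw [hf, hg]
      simp only [RCLike.inner_apply, map_mul, Complex.conj_ofReal]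
      push_cast
      ring
    rw [h1, integral_const_mul,
      Measure.integral_comp_smul volume (fun x => inner ℂ (f x) (g x)) r, Complex.real_smul,
      ← mul_assoc, ← Complex.ofReal_mul]
    have h2 : d r ^ 2 = r ^ Module.finrank ℝ V := by
      simp only [d]
      rw [← Real.rpow_natCast, ← Real.rpow_mul hr.le, Nat.cast_ofNat, div_mul_cancel₀ _ two_ne_zero,
        Real.rpow_natCast]
    rw [h2, abs_of_pos (by positivity), mul_inv_cancel₀ (by positivity), Complex.ofReal_one, one_mul]
    rfl
  refine ⟨T, fun f => ?_⟩
  rw [show T f = D r hr f from hT f]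
  exact hD r hr f

end Dilation

/-- Mathlib's Fourier transform has the kernel `exp(-2πi (x, ξ))`. The dilation by `(2π)⁻¹` removes the
factor `2π` from the exponent, and its normalization is the factor `(2π)^{-n/2}`. -/
theorem exists_isUnitaryFourier (n : ℕ) : ∃ Φ : L2Head n ≃ₗᵢ[ℂ] L2Head n, IsUnitaryFourier n Φ := by
  have hpos : 0 < (2 * Real.pi)⁻¹ := by positivity
  obtain ⟨D, hD⟩ := exists_dilation (EuclideanSpace ℝ (Fin n)) hpos
  refine ⟨(Lp.fourierTransformₗᵢ (EuclideanSpace ℝ (Fin n)) ℂ).trans D, fun f hf => ?_⟩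
  have h1 := (quasiMeasurePreserving_smul (V := EuclideanSpace ℝ (Fin n)) hpos).ae
    (fourier_Lp_two_ae_eq f hf)
  filter_upwards [hD (𝓕 f), h1] with ξ h2 h3
  change (D (𝓕 f) : EuclideanSpace ℝ (Fin n) → ℂ) ξ = _
  rw [h2, h3, finrank_euclideanSpace_fin]
  congr 2
  · rw [Real.inv_rpow (by positivity), ← Real.rpow_neg (by positivity), neg_div]
  · rw [Real.fourier_eq']
    refine integral_congr_ae (ae_of_all _ fun x => ?_)
    simp only [inner_smul_right, smul_eq_mul]
    congr 2
    push_cast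
    field_simp

end Fourier

/-! ### Indicator functions of boxes in Euclidean space -/

section HeadBox

theorem headBox_inter (n : ℕ) (a b a' b' : ℕ → ℝ) : headBox n a b ∩ headBox n a' b' =
    headBox n (fun j => max (a j) (a' j)) (fun j => min (b j) (b' j)) := by
  ext y
  simp only [headBox, mem_inter_iff, mem_ofPred_eq, mem_Ico, max_le_iff, lt_min_iff]
  exact ⟨fun h j => ⟨⟨(h.1 j).1, (h.2 j).1⟩, ⟨(h.1 j).2, (h.2 j).2⟩⟩,
    fun h => ⟨fun j => ⟨(h j).1.1, (h j).2.1⟩, fun j => ⟨(h j).1.2, (h j).2.2⟩⟩⟩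

theorem headBox_congr {n : ℕ} {a b a' b' : ℕ → ℝ} (ha : ∀ j < n, a j = a' j)
    (hb : ∀ j < n, b j = b' j) : headBox n a b = headBox n a' b' := by
  ext y
  exact forall_congr' fun i => by rw [ha i i.2, hb i i.2]

theorem volume_real_headBox {n : ℕ} {a b : ℕ → ℝ} (h : ∀ j < n, a j ≤ b j) :
    volume.real (headBox n a b) = ∏ j ∈ Finset.range n, (b j - a j) := by
  rw [Measure.real, headBox_eq, (EuclideanSpace.volume_preserving_symm_measurableEquiv_toLp
    (Fin n)).measure_preimage_equiv, Real.volume_pi_Ico, ENNReal.toReal_prod,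
    ← Fin.prod_univ_eq_prod_range]
  exact Finset.prod_congr rfl fun i _ => ENNReal.toReal_ofReal (sub_nonneg.2 (h i i.2))

theorem headBox_eq_empty {n j : ℕ} {a b : ℕ → ℝ} (hj : j < n) (h : b j ≤ a j) :
    headBox n a b = ∅ :=
  eq_empty_of_forall_notMem fun _ hy => (Ico_eq_empty (not_lt.2 h)).subset (hy ⟨j, hj⟩)

theorem inner_headBoxVec (n : ℕ) (a b a' b' : ℕ → ℝ) :
    inner ℂ (headBoxVec n a b) (headBoxVec n a' b') =
      (volume.real (headBox n (fun j => max (a j) (a' j)) (fun j => min (b j) (b' j))) : ℂ) := by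
  rw [← headBox_inter]
  exact L2.inner_indicatorConstLp_one_indicatorConstLp_one _ _ _ _

theorem norm_headBoxVec_sq (n : ℕ) (a b : ℕ → ℝ) :
    ‖headBoxVec n a b‖ ^ 2 = volume.real (headBox n a b) := by
  have h := inner_headBoxVec n a b a b
  simp only [max_self, min_self] at h
  rw [inner_self_eq_norm_sq_to_K] at h
  exact Complex.ofReal_injective (by rw [Complex.ofReal_pow]; exact h)

theorem integrable_headBoxVec (n : ℕ) (a b : ℕ → ℝ) :
    Integrable (headBoxVec n a b) (volume : Measure (EuclideanSpace ℝ (Fin n))) :=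
  integrable_indicatorConstLp _ _ _

/-- A square integrable function whose integrals over all boxes vanish is zero: the boxes are a
`π`-system generating the Borel sets. -/
theorem eq_zero_of_setIntegral_headBox {n : ℕ} (f : L2Head n)
    (h : ∀ a b : ℕ → ℝ, ∫ x in headBox n a b, f x = 0) : f = 0 := by
  let K : ℕ → Set (EuclideanSpace ℝ (Fin n)) := fun N => headBox n (fun _ => -N) fun _ => N
  have hK : ∀ N, MeasurableSet (K N) := fun N => measurableSet_headBox _ _ _
  have hint : ∀ N, IntegrableOn f (K N) := fun N =>
    integrableOn_Lp_of_measure_ne_top f one_le_two (volume_headBox_ne_top _ _ _)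
  set ψ := (MeasurableEquiv.toLp 2 (Fin n → ℝ)).symm with hψ
  have hpi : ∀ N (s : Set (Fin n → ℝ)), MeasurableSet s →
      ∫ x in ψ ⁻¹' s ∩ K N, f x = 0 := by
    intro N s hs
    induction s, hs using MeasurableSpace.induction_on_inter
      (s := pi univ '' pi univ fun _ : Fin n => {S : Set ℝ | ∃ l u, l < u ∧ Ico l u = S}) with
    | h_eq =>
      refine (generateFrom_eq_pi (fun _ => ?_) fun _ => ?_).symm
      · rw [← borel_eq_generateFrom_Ico ℝ, ← BorelSpace.measurable_eq]
      · refine ⟨fun k => Ico (-(k + 1 : ℝ)) (k + 1), fun k => ⟨_, _, ?_, rfl⟩, ?_⟩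
        · have : (0 : ℝ) ≤ k := k.cast_nonneg
          linarith
        · refine eq_univ_of_forall fun x => ?_
          obtain ⟨k, hk⟩ := exists_nat_ge |x|
          rw [abs_le] at hk
          exact mem_iUnion.2 ⟨k, by linarith [hk.1], by linarith [hk.2]⟩
    | h_inter => exact IsPiSystem.pi fun _ => isPiSystem_Ico id id
    | empty => simp
    | basic t ht =>
      obtain ⟨S, hS, rfl⟩ := ht
      have hS' : ∀ i : Fin n, ∃ l u : ℝ, l < u ∧ Ico l u = S i := fun i => hS i (mem_univ i)
      choose l u _ hlu using hS'
      have : ψ ⁻¹' univ.pi S = headBox n (fun j => if hj : j < n then l ⟨j, hj⟩ else 0)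
          (fun j => if hj : j < n then u ⟨j, hj⟩ else 0) := by
        rw [headBox_eq, ← hψ]
        congr 2
        funext i
        simp [hlu]
      rw [this, headBox_inter]
      exact h _ _
    | compl t ht ih =>
      have h1 := setIntegral_union (f := f) (s := ψ ⁻¹' t ∩ K N) (t := ψ ⁻¹' tᶜ ∩ K N)
        (μ := volume) ?_ ((ψ.measurable ht.compl).inter (hK N))
        ((hint N).mono_set inter_subset_right) ((hint N).mono_set inter_subset_right)
      · rw [← union_inter_distrib_right, ← preimage_union, union_compl_self, preimage_univ,
          univ_inter, ih, zero_add] at h1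
        rw [← h1]
        exact h _ _
      · exact (disjoint_compl_right.preimage ψ).mono inter_subset_left inter_subset_left
    | iUnion t hd ht ih =>
      rw [preimage_iUnion, iUnion_inter, integral_iUnion (fun i => (ψ.measurable (ht i)).inter (hK N))
        (fun i j hij => ((hd hij).preimage ψ).mono inter_subset_left inter_subset_left)
        ((hint N).mono_set (iUnion_subset fun i => inter_subset_right))]
      simp [ih]
  have hz : ∀ N, ∀ᵐ x ∂volume.restrict (K N), f x = 0 := fun N => by
    refine (hint N).ae_eq_zero_of_forall_setIntegral_eq_zero fun s hs _ => ?_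
    rw [Measure.restrict_restrict hs]
    have := hpi N (ψ.symm ⁻¹' s) (ψ.symm.measurable hs)
    rwa [← preimage_comp, ψ.symm_comp_self, preimage_id] at this
  have hU : ⋃ N, K N = univ := by
    refine eq_univ_of_forall fun x => ?_
    obtain ⟨k, hk⟩ := exists_nat_gt ‖x‖
    refine mem_iUnion.2 ⟨k, fun i => ?_⟩
    have := abs_le.1 ((PiLp.norm_apply_le x i).trans hk.le)
    exact ⟨this.1, (le_abs_self _).trans_lt ((PiLp.norm_apply_le x i).trans_lt hk)⟩
  rw [Lp.eq_zero_iff_ae_eq_zero]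
  have := (ae_restrict_iUnion_iff K _).2 hz
  rwa [hU, Measure.restrict_univ] at this

theorem isTotal_headBoxVec (n : ℕ) :
    IsTotal fun p : {p : (ℕ → ℝ) × (ℕ → ℝ) // ∀ j, p.1 j < p.2 j} =>
      headBoxVec n p.1.1 p.1.2 := by
  refine .of_forall_inner fun f hf => eq_zero_of_setIntegral_headBox f fun a b => ?_
  -- The index type requires `a j < b j` for all `j`, so the irrelevant terms are changed.
  by_cases h : ∀ j < n, a j < b j
  · have h1 : ∀ j, (if j < n then a j else 0) < if j < n then b j else 1 := fun j => by
      split_ifs with hj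
      exacts [h j hj, one_pos]
    have h2 := hf ⟨(fun j => if j < n then a j else 0, fun j => if j < n then b j else 1), h1⟩
    rw [headBoxVec, L2.inner_indicatorConstLp_one] at h2
    rwa [headBox_congr (a' := fun j => if j < n then a j else 0)
      (b' := fun j => if j < n then b j else 1) (fun j hj => (if_pos hj).symm)
      (fun j hj => (if_pos hj).symm)]
  · push Not at h
    obtain ⟨j, hj, hab⟩ := h
    rw [headBox_eq_empty hj hab, setIntegral_empty]

/-- The integral formula determines the unitary Fourier transform, since it applies to the indicator
functions of boxes. -/
theorem IsUnitaryFourier.unique {n : ℕ} {Φ Ψ : L2Head n ≃ₗᵢ[ℂ] L2Head n}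
    (hΦ : IsUnitaryFourier n Φ) (hΨ : IsUnitaryFourier n Ψ) : Φ = Ψ := by
  have := (isTotal_headBoxVec n).ext (f := (Φ : L2Head n →L[ℂ] L2Head n))
    (g := (Ψ : L2Head n →L[ℂ] L2Head n)) fun p => Lp.ext
      ((hΦ _ (integrable_headBoxVec _ _ _)).trans (hΨ _ (integrable_headBoxVec _ _ _)).symm)
  exact LinearIsometryEquiv.ext fun f => congrArg (fun T : L2Head n →L[ℂ] L2Head n => T f) this

/-- The matrix elements of the Fourier transform between boxes decay exponentially in the
dimension: the Fourier integral of an indicator function is at most `(2π)^{-n/2}` times the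
volume. -/
theorem IsUnitaryFourier.norm_inner_le {n : ℕ} {Φ : L2Head n ≃ₗᵢ[ℂ] L2Head n}
    (hΦ : IsUnitaryFourier n Φ) (a b a' b' : ℕ → ℝ) :
    ‖inner ℂ (headBoxVec n a' b') (Φ (headBoxVec n a b))‖ ≤
      (2 * Real.pi) ^ (-(n : ℝ) / 2) * volume.real (headBox n a b) *
        volume.real (headBox n a' b') := by
  rw [headBoxVec, L2.inner_indicatorConstLp_one]
  refine norm_setIntegral_le_of_norm_le_const_ae' (volume_headBox_ne_top n a' b').lt_top ?_
  filter_upwards [hΦ _ (integrable_headBoxVec n a b)] with ξ hξ _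
  rw [hξ, norm_mul, Complex.norm_real, Real.norm_of_nonneg (by positivity)]
  gcongr
  refine (norm_integral_le_integral_norm _).trans (le_of_eq ?_)
  rw [← integral_indicator_one (measurableSet_headBox n a b)]
  refine integral_congr_ae ?_
  filter_upwards [indicatorConstLp_coeFn (p := 2) (hs := measurableSet_headBox n a b)
    (hμs := volume_headBox_ne_top n a b) (c := (1 : ℂ))] with x hx
  rw [headBoxVec, hx, norm_mul, show -Complex.I * ((inner ℝ x ξ : ℝ) : ℂ) =
    ((-inner ℝ x ξ : ℝ) : ℂ) * Complex.I by push_cast; ring, Complex.norm_exp_ofReal_mul_I, one_mul]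
  by_cases hx' : x ∈ headBox n a b <;> simp [hx']

end HeadBox

/-! ### Square integrable functions for a finitely additive measure -/

namespace FinAddMeasure

section Total

variable {α : Type*} {μ : FinAddMeasure α}

variable (μ) in
/-- The linear map sending a simple function to its class in `L2`. -/
noncomputable def toL2 : μ.SimpleFn →ₗ[ℂ] μ.L2 :=
  ((UniformSpace.Completion.toComplL (𝕜 := ℂ) (E := SeparationQuotient μ.SimpleFn)).comp
    (SeparationQuotient.mkCLM ℂ μ.SimpleFn)).toLinearMap

theorem toL2_indicator (B : Set α) (hB : B ∈ μ.ring) :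
    μ.toL2 (SimpleFn.indicator B hB) = μ.indicator B hB := rfl

theorem isClosed_induction_L2 {V : Submodule ℂ μ.L2} (hV : IsClosed (V : Set μ.L2))
    (h : ∀ f, μ.toL2 f ∈ V) (v : μ.L2) : v ∈ V := by
  induction v using UniformSpace.Completion.induction_on with
  | hp => exact hV
  | ih q =>
    obtain ⟨f, rfl⟩ := SeparationQuotient.surjective_mk q
    exact h f

theorem inner_indicator {A B : Set α} (hA : A ∈ μ.ring) (hB : B ∈ μ.ring) :
    inner ℂ (μ.indicator A hA) (μ.indicator B hB) = ((μ.content (A ∩ B) : ℝ) : ℂ) := by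
  rw [indicator, indicator, UniformSpace.Completion.inner_coe, SeparationQuotient.inner_mk_mk,
    inner_simpleFn, ← integral_indicator]
  congr 1
  funext x
  by_cases h1 : x ∈ A <;> by_cases h2 : x ∈ B <;> simp [SimpleFn.fn, SimpleFn.indicator, h1, h2]

theorem norm_indicator_sq {A : Set α} (hA : A ∈ μ.ring) :
    ‖μ.indicator A hA‖ ^ 2 = (μ.content A : ℝ) := by
  have h := inner_indicator hA hA
  rw [inter_self] at h
  have h1 := (inner_self_eq_norm_sq_to_K (𝕜 := ℂ) (μ.indicator A hA)).symm.trans h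
  exact Complex.ofReal_injective (by rw [Complex.ofReal_pow]; exact h1)

theorem indicator_sub_indicator {A B : Set α} (hA : A ∈ μ.ring) (hB : B ∈ μ.ring) (h : B ⊆ A) :
    μ.indicator A hA - μ.indicator B hB = μ.indicator (A \ B) (μ.isSetRing.sdiff_mem hA hB) := by
  rw [← toL2_indicator, ← toL2_indicator, ← toL2_indicator, ← map_sub]
  congr 1
  refine Subtype.ext (funext fun x => ?_)
  change A.indicator (fun _ => (1 : ℂ)) x - B.indicator (fun _ => (1 : ℂ)) x =
    (A \ B).indicator (fun _ => (1 : ℂ)) x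
  by_cases h1 : x ∈ B
  · simp [h1, h h1]
  · by_cases h2 : x ∈ A <;> simp [h1, h2]

theorem completion_content {A : Set α} (hA : A ∈ μ.ring) :
    μ.completion.content A = μ.content A :=
  le_antisymm (completedValue_le hA Subset.rfl)
    (le_completedValue (ring_subset_completion hA) fun _ hC h => content_mono hA hC h)

/-- The indicator functions of the members of an intersection-stable collection are total in the
space of square integrable functions for the completed measure on the ring they generate. -/
theorem isTotal_indicator {C : Set (Set α)} (hC : ∀ A ∈ C, ∀ B ∈ C, A ∩ B = ∅ ∨ A ∩ B ∈ C)
    (hr : μ.ring = generatedRing C) (hmem : ∀ B ∈ C, B ∈ μ.completion.ring) :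
    IsTotal fun B : C => μ.completion.indicator B.1 (hmem B.1 B.2) := by
  set V := (Submodule.span ℂ (range fun B : C =>
    μ.completion.indicator B.1 (hmem B.1 B.2))).topologicalClosure with hV
  have hc : IsClosed (V : Set μ.completion.L2) := Submodule.isClosed_topologicalClosure _
  have h1 : ∀ f ∈ Submodule.span ℂ {f : α → ℂ | ∃ B ∈ C, f = B.indicator fun _ => 1},
      ∃ hf : f ∈ μ.completion.simpleFunctions,
        μ.completion.toL2 (Subtype.mk (p := (· ∈ μ.completion.simpleFunctions)) f hf) ∈ V := by
    intro f hf
    induction hf using Submodule.span_induction with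
    | mem f hf =>
      obtain ⟨B, hB, rfl⟩ := hf
      exact ⟨indicator_mem_simpleFunctions (hmem B hB),
        subset_closure (Submodule.subset_span ⟨⟨B, hB⟩, rfl⟩)⟩
    | zero => exact ⟨Submodule.zero_mem _, by
        convert V.zero_mem
        exact map_zero μ.completion.toL2⟩
    | add f g _ _ hf hg =>
      obtain ⟨hf, hf'⟩ := hf
      obtain ⟨hg, hg'⟩ := hg
      refine ⟨Submodule.add_mem _ hf hg, ?_⟩
      convert V.add_mem hf' hg'
      exact (map_add μ.completion.toL2 (Subtype.mk (p := (· ∈ μ.completion.simpleFunctions)) f hf)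
        (Subtype.mk (p := (· ∈ μ.completion.simpleFunctions)) g hg))
    | smul c f _ hf =>
      obtain ⟨hf, hf'⟩ := hf
      refine ⟨Submodule.smul_mem _ c hf, ?_⟩
      convert V.smul_mem c hf'
      exact (map_smul μ.completion.toL2 c
        (Subtype.mk (p := (· ∈ μ.completion.simpleFunctions)) f hf))
  -- Sets of the generated ring, then sets of its completion, then all simple functions.
  have h2 : ∀ A (hA : A ∈ μ.ring), μ.completion.indicator A (ring_subset_completion hA) ∈ V :=
    fun A hA => (h1 _ (indicator_mem_span hC (hr ▸ hA))).2
  have h3 : ∀ A (hA : A ∈ μ.completion.ring), μ.completion.indicator A hA ∈ V := by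
    intro A hA
    refine hc.closure_subset (Metric.mem_closure_iff.2 fun ε hε => ?_)
    obtain ⟨B, hB, D, hD, hBA, hAD, hlt⟩ := hA (⟨ε, hε.le⟩ ^ 2) (pow_pos hε 2)
    refine ⟨_, h2 B hB, ?_⟩
    have hDB := μ.isSetRing.sdiff_mem hD hB
    have e1 := norm_indicator_sq (μ.completion.isSetRing.sdiff_mem hA (ring_subset_completion hB))
    rw [dist_eq_norm, indicator_sub_indicator hA (ring_subset_completion hB) hBA]
    refine lt_of_pow_lt_pow_left₀ 2 hε.le ?_
    rw [e1]
    have e2 : μ.completion.content (A \ B) ≤ μ.content (D \ B) := by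
      rw [← completion_content hDB]
      exact content_mono (μ.completion.isSetRing.sdiff_mem hA (ring_subset_completion hB))
        (ring_subset_completion hDB) (sdiff_subset_sdiff_left hAD)
    exact_mod_cast NNReal.coe_lt_coe.2 (e2.trans_lt hlt)
  have h4 : μ.completion.simpleFunctions ≤
      Submodule.map (μ.completion.simpleFunctions.subtype)
        (V.comap (μ.completion.toL2 : μ.completion.simpleFunctions →ₗ[ℂ] μ.completion.L2)) := by
    refine Submodule.span_le.2 ?_
    rintro _ ⟨B, hB, rfl⟩
    exact ⟨⟨_, indicator_mem_simpleFunctions hB⟩, h3 B hB, rfl⟩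
  rw [IsTotal, Submodule.dense_iff_topologicalClosure_eq_top, ← hV, Submodule.eq_top_iff']
  refine isClosed_induction_L2 hc fun f => ?_
  obtain ⟨g, hg, hgf⟩ := h4 (Subtype.property (p := (· ∈ μ.completion.simpleFunctions)) f)
  have : g = f := Subtype.ext hgf
  rw [← this]
  exact hg

end Total

end FinAddMeasure

/-! ### Blocks and their products -/

section Blocks

variable {E : Type*} [NormedAddCommGroup E] [InnerProductSpace ℝ E] {e : HilbertBasis ℕ ℝ E}

theorem block_inter (e : HilbertBasis ℕ ℝ E) (a b a' b' : ℕ → ℝ) :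
    block e a b ∩ block e a' b' =
      block e (fun j => max (a j) (a' j)) (fun j => min (b j) (b' j)) := by
  ext y
  simp only [block, mem_inter_iff, mem_ofPred_eq, mem_Ico, max_le_iff, lt_min_iff]
  exact ⟨fun h j => ⟨⟨(h.1 j).1, (h.2 j).1⟩, ⟨(h.1 j).2, (h.2 j).2⟩⟩,
    fun h => ⟨fun j => ⟨(h j).1.1, (h j).2.1⟩, fun j => ⟨(h j).1.2, (h j).2.2⟩⟩⟩

theorem lt_of_block_nonempty {a b : ℕ → ℝ} (h : (block e a b).Nonempty) (j : ℕ) : a j < b j := by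
  obtain ⟨x, hx⟩ := h
  exact (hx j).1.trans_lt (hx j).2

theorem IsAbsMeasurableBlock.inter {a b a' b' : ℕ → ℝ} (h : IsAbsMeasurableBlock e a b)
    (h' : IsAbsMeasurableBlock e a' b')
    (hne : (block e (fun j => max (a j) (a' j)) (fun j => min (b j) (b' j))).Nonempty) :
    IsAbsMeasurableBlock e (fun j => max (a j) (a' j)) (fun j => min (b j) (b' j)) := by
  obtain ⟨M, hM⟩ := h.bounded_left
  obtain ⟨M', hM'⟩ := h'.bounded_left
  obtain ⟨N, hN⟩ := h.bounded_right
  obtain ⟨N', hN'⟩ := h'.bounded_right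
  have hlt := lt_of_block_nonempty hne
  refine ⟨⟨max M M', ?_⟩, ⟨max N N', ?_⟩, hlt, Or.inr ?_⟩
  · rintro _ ⟨j, rfl⟩
    exact abs_max_le_max_abs_abs.trans (max_le_max (hM ⟨j, rfl⟩) (hM' ⟨j, rfl⟩))
  · rintro _ ⟨j, rfl⟩
    exact abs_min_le_max_abs_abs.trans (max_le_max (hN ⟨j, rfl⟩) (hN' ⟨j, rfl⟩))
  · have hne' : (block e a b).Nonempty := (block_inter e a b a' b' ▸ hne).mono inter_subset_left
    refine Summable.of_nonneg_of_le (fun j => le_max_left _ _) (fun j => ?_)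
      (h.summable.resolve_left hne'.ne_empty)
    refine max_le_max le_rfl (Real.log_le_log (sub_pos.2 (hlt j)) ?_)
    exact sub_le_sub (min_le_left _ _) (le_max_left _ _)

/-- The Gram matrix of the block vectors: the intersection of two blocks has the maxima and minima of
their endpoints as its endpoints, and `blockVolume` is `0` if it is empty. -/
theorem inner_blockVec {a b a' b' : ℕ → ℝ} (h : IsAbsMeasurableBlock e a b)
    (h' : IsAbsMeasurableBlock e a' b') : inner ℂ (blockVec h) (blockVec h') =
      (blockVolume e (fun j => max (a j) (a' j)) (fun j => min (b j) (b' j)) : ℂ) := by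
  rw [blockVec, blockVec, FinAddMeasure.inner_indicator, block_inter]
  congr 1
  rcases (block e (fun j => max (a j) (a' j)) (fun j => min (b j) (b' j))).eq_empty_or_nonempty
    with h0 | hne
  · simp [blockVolume, h0]
  · have hi := h.inter h' hne
    rw [← (BlockMeasure.exists_content e).choose_spec _ _ hi]
    exact congrArg _ (FinAddMeasure.completion_content (μ := ringMeasure e)
      (subset_generatedRing _ ⟨_, _, hi, rfl⟩))

theorem blockVec_eq_zero {a b : ℕ → ℝ} (h : IsAbsMeasurableBlock e a b) (h0 : block e a b = ∅) :
    blockVec h = 0 := by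
  have h1 := FinAddMeasure.norm_indicator_sq (block_mem_ring h)
  have h2 : (shiftMeasure e).content (block e a b) = 0 := by rw [h0, addContent_empty]
  rw [h2, NNReal.coe_zero, sq_eq_zero_iff] at h1
  exact norm_eq_zero.1 h1

theorem blockVec_congr {a b a' b' : ℕ → ℝ} (h : IsAbsMeasurableBlock e a b)
    (h' : IsAbsMeasurableBlock e a' b') (ha : a = a') (hb : b = b') : blockVec h = blockVec h' := by
  subst ha hb
  rfl

variable (e) in
theorem isTotal_blockVec :
    IsTotal fun p : {p : (ℕ → ℝ) × (ℕ → ℝ) // IsAbsMeasurableBlock e p.1 p.2} =>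
      blockVec p.2 := by
  refine (FinAddMeasure.isTotal_indicator (μ := ringMeasure e)
    (fun A hA B hB => BlockMeasure.inter_block e hA hB) rfl
    fun B hB => FinAddMeasure.ring_subset_completion (subset_generatedRing _ hB)).of_range_subset ?_
  rintro _ ⟨⟨_, a, b, h, rfl⟩, rfl⟩
  exact ⟨⟨(a, b), h⟩, rfl⟩

/-- The partial products of the side lengths of a nonempty absolutely measurable block converge. -/
theorem tendsto_norm_headBoxVec {a b : ℕ → ℝ} (h : IsAbsMeasurableBlock e a b)
    (hne : (block e a b).Nonempty) :
    Tendsto (fun n => ‖headBoxVec n a b‖) atTop (𝓝 √(∏' j, (b j - a j))) := by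
  have hp := (BlockMeasure.multipliable_of_summable_log (fun j => (sub_pos.2 (h.lt j)).le)
    (h.summable.resolve_left hne.ne_empty)).hasProd.tendsto_prod_nat
  refine ((Real.continuous_sqrt.tendsto _).comp hp).congr fun n => ?_
  rw [Function.comp_apply, ← volume_real_headBox fun j _ => (h.lt j).le, ← norm_headBoxVec_sq,
    Real.sqrt_sq (norm_nonneg _)]

variable [CompleteSpace E]

/-- Whether a block contains a vector of `E` depends only on its tail. -/
theorem block_nonempty_iff_tail {a b : ℕ → ℝ} (n : ℕ) (h : ∀ j < n, a j < b j) :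
    (block e a b).Nonempty ↔
      (block (tailBasis e n) (fun j => a (n + j)) (fun j => b (n + j))).Nonempty := by
  have hsum : ∀ (c : ℕ → ℝ) (j : ℕ),
      inner ℝ (e j) (∑ i ∈ Finset.range n, c i • e i) = if j < n then c j else 0 := by
    intro c j
    simp only [inner_sum, inner_smul_right, orthonormal_iff_ite.1 e.orthonormal]
    simp
  constructor
  · rintro ⟨x, hx⟩
    have hmem : x - ∑ i ∈ Finset.range n, (inner ℝ (e i) x : ℝ) • e i ∈ tail e n := by
      rw [tail, Submodule.mem_orthogonal]
      intro y hy
      induction hy using Submodule.span_induction with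
      | mem y hy =>
        obtain ⟨k, hk, rfl⟩ := hy
        have hk' : k < n := hk
        rw [inner_sub_right, hsum (fun i => inner ℝ (e i) x), if_pos hk', sub_self]
      | zero => exact inner_zero_left _
      | add y z _ _ hy hz => rw [inner_add_left, hy, hz, add_zero]
      | smul c y _ hy => rw [inner_smul_left, hy, mul_zero]
    refine ⟨⟨_, hmem⟩, fun j => ?_⟩
    rw [inner_tailBasis, inner_sub_right, hsum (fun i => inner ℝ (e i) x), if_neg (by omega),
      sub_zero]
    exact hx (n + j)
  · rintro ⟨y, hy⟩
    -- The first coordinates may be any points of the sides, for instance the left endpoints.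
    refine ⟨(y : E) + ∑ i ∈ Finset.range n, a i • e i, fun j => ?_⟩
    rw [inner_add_right, hsum]
    by_cases hj : j < n
    · rw [if_pos hj, inner_basis_tail e hj, zero_add]
      exact ⟨le_rfl, h j hj⟩
    · have := hy (j - n)
      rw [inner_tailBasis] at this
      simpa [hj, Nat.add_sub_cancel' (not_lt.1 hj)] using this

/-- The volume of a block is the product of the volume of its head, a box in Euclidean space, and
of its tail. -/
theorem blockVolume_eq_mul {a b : ℕ → ℝ} (n : ℕ)
    (h : (block e a b).Nonempty → Summable fun j => max 0 (Real.log (b j - a j))) :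
    blockVolume e a b = volume.real (headBox n a b) *
      blockVolume (tailBasis e n) (fun j => a (n + j)) (fun j => b (n + j)) := by
  by_cases hlt : ∀ j < n, a j < b j
  · by_cases hne : (block e a b).Nonempty
    · have hs := h hne
      have h0 : ∀ j, 0 ≤ b j - a j := fun j => (sub_pos.2 (lt_of_block_nonempty hne j)).le
      have m1 := BlockMeasure.multipliable_of_summable_log h0 hs
      have m2 := BlockMeasure.multipliable_of_summable_log (c := fun j => b (n + j) - a (n + j))
        (fun j => h0 (n + j)) (hs.comp_injective (add_right_injective n))
      rw [blockVolume, if_pos hne, blockVolume, if_pos ((block_nonempty_iff_tail n hlt).1 hne),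
        volume_real_headBox fun j hj => (hlt j hj).le]
      have t1 := m1.hasProd.tendsto_prod_nat.comp (tendsto_add_atTop_nat n)
      have t2 := (m2.hasProd.tendsto_prod_nat).const_mul (∏ j ∈ Finset.range n, (b j - a j))
      refine tendsto_nhds_unique t1 (t2.congr fun m => ?_)
      rw [Function.comp_apply, add_comm m n, Finset.prod_range_add]
    · have hne' := mt (block_nonempty_iff_tail n hlt).2 hne
      rw [blockVolume, if_neg hne, blockVolume, if_neg hne', mul_zero]
  · have hne : ¬ (block e a b).Nonempty := fun hne => hlt fun j _ => lt_of_block_nonempty hne j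
    push Not at hlt
    obtain ⟨j, hj, hab⟩ := hlt
    rw [blockVolume, if_neg hne, headBox_eq_empty hj hab]
    simp

/-- The sequence whose first `n` terms are those of `a` and whose remaining terms are `a'`. -/
def glue (n : ℕ) (a a' : ℕ → ℝ) (j : ℕ) : ℝ := if j < n then a j else a' (j - n)

theorem glue_of_lt {n j : ℕ} (h : j < n) (a a' : ℕ → ℝ) : glue n a a' j = a j := if_pos h

theorem glue_add (n : ℕ) (a a' : ℕ → ℝ) : (fun j => glue n a a' (n + j)) = a' := by
  funext j
  simp [glue]

theorem bddAbove_glue (n : ℕ) (a : ℕ → ℝ) {a' : ℕ → ℝ} (h : BddAbove (range fun j => |a' j|)) :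
    BddAbove (range fun j => |glue n a a' j|) := by
  refine (((Finset.range n).image fun j => |a j|).bddAbove.union h).mono ?_
  rintro _ ⟨j, rfl⟩
  by_cases hj : j < n
  · left
    simp only [glue_of_lt hj]
    exact Finset.mem_coe.2 (Finset.mem_image_of_mem _ (Finset.mem_range.2 hj))
  · right
    exact ⟨j - n, by simp [glue, hj]⟩

/-- The product of a box in `E_n` and of an absolutely measurable block of `E^n` is an absolutely
measurable block of `E`. -/
theorem IsAbsMeasurableBlock.glue {n : ℕ} {a b a' b' : ℕ → ℝ} (hab : ∀ j, a j < b j)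
    (h : IsAbsMeasurableBlock (tailBasis e n) a' b') :
    IsAbsMeasurableBlock e (glue n a a') (glue n b b') := by
  have hlt : ∀ j, QuantumWalk.glue n a a' j < QuantumWalk.glue n b b' j := fun j => by
    unfold QuantumWalk.glue
    split_ifs
    exacts [hab j, h.lt _]
  refine ⟨bddAbove_glue n a h.bounded_left, bddAbove_glue n b h.bounded_right, hlt, ?_⟩
  rcases h.summable with h0 | hs
  · left
    rw [← not_nonempty_iff_eq_empty, block_nonempty_iff_tail n fun j _ => hlt j, glue_add,
      glue_add, h0]
    exact not_nonempty_empty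
  · right
    rw [← summable_nat_add_iff n]
    refine hs.congr fun j => ?_
    rw [add_comm j n, congrFun (glue_add n a a') j, congrFun (glue_add n b b') j]

variable (e) in
/-- The products of a box and a block that come from one block of `E` are already total, because
any box and any block can be glued. -/
theorem isTotal_headBoxVec_tmul_blockVec (n : ℕ) :
    IsTotal fun p : {p : (ℕ → ℝ) × (ℕ → ℝ) // IsAbsMeasurableBlock e p.1 p.2} =>
      ((headBoxVec n p.1.1 p.1.2 ⊗ₜ[ℂ] blockVec (p.2.tail n) :
        L2Head n ⊗[ℂ] HE (tailBasis e n)) : HeadTail e n) := by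
  refine ((isTotal_headBoxVec n).tmul (isTotal_blockVec (tailBasis e n))).of_range_subset ?_
  rintro _ ⟨⟨⟨⟨a, b⟩, hab⟩, ⟨⟨a', b'⟩, h⟩⟩, rfl⟩
  refine ⟨⟨(glue n a a', glue n b b'), h.glue hab⟩, ?_⟩
  have h1 : headBoxVec n (glue n a a') (glue n b b') = headBoxVec n a b := by
    have := headBox_congr (a := glue n a a') (b := glue n b b') (a' := a) (b' := b)
      (fun j hj => glue_of_lt hj a a') (fun j hj => glue_of_lt hj b b')
    simp only [headBoxVec, this]
  have h2 : blockVec ((h.glue hab).tail n) = blockVec h :=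
    blockVec_congr _ _ (glue_add n a a') (glue_add n b b')
  simp only [h1, h2]

variable (e) in
/-- The identification `L_2(E_n) ⊗ 𝓗_{𝓔^n} = 𝓗_𝓔` exists since the volume of blocks is
multiplicative. -/
theorem exists_isIdentification (n : ℕ) : ∃ U : HeadTail e n ≃ₗᵢ[ℂ] HE e,
    IsIdentification e n U := by
  obtain ⟨U, hU⟩ := (isTotal_headBoxVec_tmul_blockVec e n).exists_linearIsometryEquiv
    (isTotal_blockVec e) fun p q => by
      rw [UniformSpace.Completion.inner_coe, TensorProduct.inner_tmul, inner_headBoxVec,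
        inner_blockVec, inner_blockVec, ← Complex.ofReal_mul]
      exact congrArg _ (blockVolume_eq_mul n fun hne =>
        (p.2.inter q.2 hne).summable.resolve_left hne.ne_empty)
  exact ⟨U, fun a b h => hU ⟨(a, b), h⟩⟩

/-- The conditions on blocks of `E` determine the identification, since every product of a box of `E_n`
and a block of `E^n` is a block of `E`. -/
theorem IsIdentification.unique {n : ℕ} {U U' : HeadTail e n ≃ₗᵢ[ℂ] HE e}
    (h : IsIdentification e n U) (h' : IsIdentification e n U') : U = U' := by
  have := (isTotal_headBoxVec_tmul_blockVec e n).ext (f := (U : HeadTail e n →L[ℂ] HE e))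
    (g := (U' : HeadTail e n →L[ℂ] HE e)) fun p => (h _ _ p.2).trans (h' _ _ p.2).symm
  exact LinearIsometryEquiv.ext fun f => congrArg (fun T : HeadTail e n →L[ℂ] HE e => T f) this

end Blocks

/-! ### Partial Fourier transforms -/

section PartialFourierTransform

variable {E : Type*} [NormedAddCommGroup E] [InnerProductSpace ℝ E] [CompleteSpace E]
  {e : HilbertBasis ℕ ℝ E}

variable (e) in
/-- The partial Fourier transform `U (Φ ⊗ I) U⁻¹` exists and is unitary. -/
theorem exists_isPartialFourier (n : ℕ) :
    ∃ T ∈ unitary (HE e →L[ℂ] HE e), IsPartialFourier e n T := by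
  obtain ⟨Φ, hΦ⟩ := exists_isUnitaryFourier n
  obtain ⟨U, hU⟩ := exists_isIdentification e n
  obtain ⟨W, hW⟩ := exists_completion_rTensor (Y := HE (tailBasis e n)) Φ
  let S : HE e ≃ₗᵢ[ℂ] HE e := (U.symm.trans W).trans U
  refine ⟨_, (Unitary.linearIsometryEquiv.symm S).2, Φ, U, hΦ, hU, fun f g => ?_⟩
  change U (W (U.symm (U _))) = _
  rw [U.symm_apply_apply, hW]

theorem IsPartialFourier.unique {n : ℕ} {T T' : HE e →L[ℂ] HE e} (h : IsPartialFourier e n T)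
    (h' : IsPartialFourier e n T') : T = T' := by
  obtain ⟨Φ, U, hΦ, hU, hT⟩ := h
  obtain ⟨Φ', U', hΦ', hU', hT'⟩ := h'
  obtain rfl := hΦ.unique hΦ'
  obtain rfl := hU.unique hU'
  refine (isTotal_blockVec e).ext fun p => ?_
  rw [← hU _ _ p.2, hT, hT']

theorem IsIdentification.norm_blockVec {n : ℕ} {U : HeadTail e n ≃ₗᵢ[ℂ] HE e}
    (hU : IsIdentification e n U) {a b : ℕ → ℝ} (h : IsAbsMeasurableBlock e a b) :
    ‖blockVec h‖ = ‖headBoxVec n a b‖ * ‖blockVec (h.tail n)‖ := by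
  rw [← hU a b h, U.norm_map, UniformSpace.Completion.norm_coe, TensorProduct.norm_tmul]

/-- The matrix elements of the partial Fourier transform between blocks. The factor
`(2π)^{-n/2}` comes from the first `n` variables, and the tails of the blocks are absorbed into
the norms of the blocks. -/
theorem IsPartialFourier.norm_inner_le {n : ℕ} {T : HE e →L[ℂ] HE e} (h : IsPartialFourier e n T)
    {a b a' b' : ℕ → ℝ} (hab : IsAbsMeasurableBlock e a b) (hab' : IsAbsMeasurableBlock e a' b') :
    ‖inner ℂ (blockVec hab') (T (blockVec hab))‖ ≤ (2 * Real.pi) ^ (-(n : ℝ) / 2) *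
      (‖headBoxVec n a b‖ * ‖headBoxVec n a' b'‖ * (‖blockVec hab‖ * ‖blockVec hab'‖)) := by
  obtain ⟨Φ, U, hΦ, hU, hT⟩ := h
  have e0 : ∀ s t : L2Head n ⊗[ℂ] HE (tailBasis e n),
      inner ℂ (U (s : HeadTail e n)) (U (t : HeadTail e n)) = inner ℂ s t := fun s t =>
    (LinearIsometryEquiv.inner_map_map (𝕜 := ℂ) U (s : HeadTail e n) t).trans
      (UniformSpace.Completion.inner_coe s t)
  have e1 : inner ℂ (blockVec hab') (T (blockVec hab)) =
      inner ℂ (headBoxVec n a' b') (Φ (headBoxVec n a b)) *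
        inner ℂ (blockVec (hab'.tail n)) (blockVec (hab.tail n)) := by
    rw [← hU _ _ hab, hT, ← hU _ _ hab', e0, TensorProduct.inner_tmul]
  have e2 := hΦ.norm_inner_le a b a' b'
  rw [← norm_headBoxVec_sq, ← norm_headBoxVec_sq] at e2
  rw [e1, norm_mul, hU.norm_blockVec hab, hU.norm_blockVec hab']
  have e3 := norm_inner_le_norm (𝕜 := ℂ) (blockVec (hab'.tail n)) (blockVec (hab.tail n))
  refine (mul_le_mul e2 e3 (norm_nonneg _)
    (by positivity)).trans (le_of_eq ?_)
  ring

theorem tendsto_two_pi_rpow_neg_half :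
    Tendsto (fun n : ℕ => (2 * Real.pi) ^ (-(n : ℝ) / 2)) atTop (𝓝 0) := by
  have h1 : 1 < 2 * Real.pi := by linarith [Real.pi_gt_three]
  have h2 := tendsto_pow_atTop_nhds_zero_of_lt_one (r := (2 * Real.pi) ^ (-(1 / 2) : ℝ))
    (by positivity) (Real.rpow_lt_one_of_one_lt_of_neg h1 (by norm_num))
  refine h2.congr fun n => ?_
  rw [← Real.rpow_natCast, ← Real.rpow_mul (by positivity)]
  congr 1
  ring

theorem tendsto_inner_blockVec {F : ℕ → HE e →L[ℂ] HE e} (hF : ∀ n, IsPartialFourier e n (F n))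
    {a b a' b' : ℕ → ℝ} (hab : IsAbsMeasurableBlock e a b) (hab' : IsAbsMeasurableBlock e a' b') :
    Tendsto (fun n => inner ℂ (blockVec hab') (F n (blockVec hab))) atTop (𝓝 0) := by
  rcases (block e a b).eq_empty_or_nonempty with h0 | hne
  · simp [blockVec_eq_zero hab h0]
  rcases (block e a' b').eq_empty_or_nonempty with h0 | hne'
  · simp [blockVec_eq_zero hab' h0]
  refine squeeze_zero_norm (fun n => (hF n).norm_inner_le hab hab') ?_
  have := tendsto_two_pi_rpow_neg_half.mul (((tendsto_norm_headBoxVec hab hne).mul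
    (tendsto_norm_headBoxVec hab' hne')).mul_const (‖blockVec hab‖ * ‖blockVec hab'‖))
  rwa [zero_mul] at this

end PartialFourierTransform

end QuantumWalk

theorem mainTheorem12 {E : Type*} [NormedAddCommGroup E] [InnerProductSpace ℝ E] [CompleteSpace E]
    (e : HilbertBasis ℕ ℝ E) :
    ∃ F : ℕ → (QuantumWalk.HE e →L[ℂ] QuantumWalk.HE e),
      (∀ n T, QuantumWalk.IsPartialFourier e n T ↔ T = F n) ∧
      (∀ n, F n ∈ unitary (QuantumWalk.HE e →L[ℂ] QuantumWalk.HE e)) ∧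
      ∀ u v : QuantumWalk.HE e, Tendsto (fun n => inner ℂ u (F n v)) atTop (𝓝 0) := by
  choose F hFu hF using QuantumWalk.exists_isPartialFourier e
  refine ⟨F, fun n T => ⟨fun h => h.unique (hF n), fun h => h ▸ hF n⟩, hFu, ?_⟩
  refine (QuantumWalk.isTotal_blockVec e).tendsto_inner_zero (fun n v => ?_)
    fun p q => QuantumWalk.tendsto_inner_blockVec hF q.2 p.2
  exact ((Unitary.linearIsometryEquiv ⟨F n, hFu n⟩).norm_map v).le
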